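/- Let $\mathbb K\in\{\mathbb R,\mathbb C\}$. A \emph{Saks space} $(X,\|\cdot\|_X,\tau_X)$ is a Banach space $(X,\|\cdot\|_X)$ over $\mathbb K$ with a Hausdorff locally convex topology $\tau_X$ coarser than the norm topology such that $(X,\tau_X)'$ is norming, i.e. $\|x\|_X=\sup\{|x'(x)| : x'\in (X,\tau_X)',\ \|x'\|_{X'}\le 1\}$ for all $x\in X$. Its \emph{mixed topology} $\gamma_X$ is the finest linear topology that lies between $\tau_X$ and the norm topology and coincides with $\tau_X$ on norm-bounded sets. The Saks space is \emph{sequentially complete} if $(X,\gamma_X)$ is sequentially complete, and \emph{C-sequential} if every convex sequentially $\gamma_X$-open subset of $X$ is $\gamma_X$-open. A semigroup $(S_t)_{t\ge 0}$ in $\mathcal L(X)$ ($S_0=I$, $S_{s+t}=S_sS_t$) is \emph{locally $\tau_X$-bi-continuous} if (i) there are $M\ge 1$, $\omega\in\mathbb R$ with $\|S_t\|\le Me^{\omega t}$ for all $t\ge 0$; (ii) $t\mapsto S_tx\in(X,\tau_X)$ is continuous on $[0,\infty)$ for every $x\in X$; (iii) for every norm-bounded sequence $(x_n)$ in $X$ that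 $\tau_X$-converges to some $x\in X$ one has $\tau_X\text{-}\lim_{n} S_t(x_n-x)=0$ uniformly for $t$ in compact subsets of $[0,\infty)$. For a Saks space $(U,\|\cdot\|_U,\tau_U)$ and $T>0$ let $C_{\tau,b}([0,T];U)$ be the space of all $\|\cdot\|_U$-bounded functions $f\colon[0,T]\to U$ that are continuous into $(U,\tau_U)$, with the norm $\|f\|_\infty=\sup_{t\in[0,T]}\|f(t)\|_U$; let $\gamma_\infty$ be the locally convex topology on it generated by the seminorms $f\mapsto\sup_{t\in[0,T]}p(f(t))$, where $p$ runs through the $\gamma_U$-continuous seminorms on $U$. For a linear topology $\vartheta$ on $X$ and $f\colon[0,T]\to X$, the element $x\in X$ is the \emph{$\vartheta$-Pettis integral} of $f$ if for every $x'\in(X,\vartheta)'$ the function $x'\circ f$ is Lebesgue integrable on $[0,T]$ with $\int_0^T x'(f(t))\,dt=x'(x)$. Finally, let $$X^\circ=\{x'\in X' : x' \text{ is sequentially } \tau_X\text{-continuous on } \|\cdot\|_X\text{-bounded sets}\}.$$ \textbf{Proposition.} Let $(X,\|\cdot\|_X,\tau_X)$ be a sequentially complete C-sequential Saks space, $(U,\|\cdot\|_U,\tau_U)$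 a Saks space over the same field, $(S_t)_{t\ge0}$ a locally $\tau_X$-bi-continuous semigroup on $X$, and let $B\in\mathcal L(U;X)$ be also $\tau_U$-$\tau_X$-continuous on $\|\cdot\|_U$-bounded sets. (a) $(S_tB)_{t\ge0}$ is quasi-$\gamma_U$-$\gamma_X$-equicontinuous: there is $\alpha\in\mathbb R$ such that for every $\gamma_X$-neighbourhood $V$ of $0$ there is a $\gamma_U$-neighbourhood $W$ of $0$ with $e^{-\alpha t}S_tB(W)\subseteq V$ for all $t\ge0$. (b) Let $T>0$. For every $u\in C_{\tau,b}([0,T];U)$ the function $t\mapsto S_{T-t}Bu(t)$ on $[0,T]$ has a $\tau_X$-Pettis integral $\mathcal B^Tu=\int_0^TS_{T-t}Bu(t)\,dt\in X$, which is also its $\gamma_X$-Pettis integral. The map $\mathcal B^T\colon C_{\tau,b}([0,T];U)\to X$ is linear and bounded from $(C_{\tau,b}([0,T];U),\|\cdot\|_\infty)$ to $(X,\|\cdot\|_X)$, and it is also $\gamma_\infty$-$\gamma_X$-continuous. (c) For every $T>0$ and every $x^\circ\in X^\circ$, the functional $(\mathcal B^T)'x^\circ=x^\circ\circ\mathcal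 B^T$ belongs to $(C_{\tau,b}([0,T];U),\gamma_\infty)'$. -/

import Mathlib

open Set Filter Topology MeasureTheory
open scoped NNReal ENNReal

namespace SaksControl

/-- The topology of the norm. (Topologies other than the norm topology are never registered
as instances below; they are always passed explicitly.) -/
abbrev normTopology (X : Type*) [NormedAddCommGroup X] : TopologicalSpace X :=
  UniformSpace.toTopologicalSpace

/-- The linear topologies `t` on `X` which coincide with `τ` on norm-bounded sets and satisfy
`τ ⊆ t ⊆ τ_{‖·‖}` as families of open sets. (In Mathlib, `t ≤ s` means that `t` is finer.) -/
def mixedCandidates (𝕜 : Type*) {X : Type*} [RCLike 𝕜] [NormedAddCommGroup X] [NormedSpace 𝕜 X]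
    (τ : TopologicalSpace X) : Set (TopologicalSpace X) :=
  {t | @IsTopologicalAddGroup X t _ ∧ @ContinuousSMul 𝕜 X _ _ t ∧
    t ≤ τ ∧ normTopology X ≤ t ∧
    ∀ s : Set X, Bornology.IsBounded s →
      t.induced (Subtype.val : s → X) = τ.induced (Subtype.val : s → X)}

/-- The mixed topology `γ(‖·‖, τ)`: the finest of the candidates. -/
def mixedTopology (𝕜 : Type*) {X : Type*} [RCLike 𝕜] [NormedAddCommGroup X] [NormedSpace 𝕜 X]
    (τ : TopologicalSpace X) : TopologicalSpace X :=
  sInf (mixedCandidates 𝕜 τ)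

/-- The finest candidate exists, i.e. the mixed topology is itself a candidate. -/
theorem isLeast_mixedTopology (𝕜 : Type*) {X : Type*} [RCLike 𝕜] [NormedAddCommGroup X]
    [NormedSpace 𝕜 X] (τ : TopologicalSpace X) (h₁ : @IsTopologicalAddGroup X τ _)
    (h₂ : @ContinuousSMul 𝕜 X _ _ τ) (h₃ : normTopology X ≤ τ) :
    IsLeast (mixedCandidates 𝕜 τ) (mixedTopology 𝕜 τ) := by
  have hτ : τ ∈ mixedCandidates 𝕜 τ := ⟨h₁, h₂, le_rfl, h₃, fun _ _ => rfl⟩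
  refine ⟨⟨?_, ?_, sInf_le hτ, le_sInf fun t ht => ht.2.2.2.1, ?_⟩, fun t ht => sInf_le ht⟩
  · exact topologicalAddGroup_sInf fun t ht => ht.1
  · exact continuousSMul_sInf fun t ht => ht.2.1
  · intro s hs
    refine le_antisymm (induced_mono (sInf_le hτ)) ?_
    rw [mixedTopology, sInf_eq_iInf, induced_iInf]
    refine le_iInf fun t => ?_
    rw [induced_iInf]
    exact le_iInf fun ht => (ht.2.2.2.2 s hs).ge

/-- A Saks space structure on the normed space `X`: completeness of the norm together with a
coarser Hausdorff locally convex topology `tau` whose topological dual is norming, i.e.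
`‖x‖ = sup {|x'(x)| : x' ∈ (X, tau)', ‖x'‖ ≤ 1}`. -/
structure SaksSpace (𝕜 X : Type*) [RCLike 𝕜] [NormedAddCommGroup X] [NormedSpace 𝕜 X]
    [NormedSpace ℝ X] where
  tau : TopologicalSpace X
  complete : CompleteSpace X
  topologicalAddGroup : @IsTopologicalAddGroup X tau _
  continuousSMul : @ContinuousSMul 𝕜 X _ _ tau
  locallyConvex : @LocallyConvexSpace ℝ X _ _ _ _ tau
  t2 : @T2Space X tau
  norm_le_tau : normTopology X ≤ tau
  norming : ∀ x : X, IsLUB {r : ℝ | ∃ x' : X →ₗ[𝕜] 𝕜,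
    Continuous[tau, inferInstance] x' ∧ (∀ y, ‖x' y‖ ≤ ‖y‖) ∧ r = ‖x' x‖} ‖x‖

/-- The mixed topology `γ_X` of a Saks space. -/
def SaksSpace.gamma {𝕜 X : Type*} [RCLike 𝕜] [NormedAddCommGroup X] [NormedSpace 𝕜 X]
    [NormedSpace ℝ X] (𝓢 : SaksSpace 𝕜 X) : TopologicalSpace X :=
  mixedTopology 𝕜 𝓢.tau

/-- Every `γ_X`-Cauchy sequence is `γ_X`-convergent. -/
def SaksSpace.SequentiallyComplete {𝕜 X : Type*} [RCLike 𝕜] [NormedAddCommGroup X]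
    [NormedSpace 𝕜 X] [NormedSpace ℝ X] (𝓢 : SaksSpace 𝕜 X) : Prop :=
  ∀ x : ℕ → X,
    (∀ V ∈ @nhds X 𝓢.gamma 0, ∃ N : ℕ, ∀ m ≥ N, ∀ n ≥ N, x m - x n ∈ V) →
    ∃ a : X, Tendsto x atTop (@nhds X 𝓢.gamma a)

/-- Sequentially open sets: a sequence converging to a point of `s` is eventually in `s`. -/
def IsSequentiallyOpen {X : Type*} (t : TopologicalSpace X) (s : Set X) : Prop :=
  ∀ (x : ℕ → X), ∀ a ∈ s, Tendsto x atTop (@nhds X t a) → ∀ᶠ n in atTop, x n ∈ s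

/-- Every convex sequentially `γ_X`-open set is `γ_X`-open. -/
def SaksSpace.CSequential {𝕜 X : Type*} [RCLike 𝕜] [NormedAddCommGroup X] [NormedSpace 𝕜 X]
    [NormedSpace ℝ X] (𝓢 : SaksSpace 𝕜 X) : Prop :=
  ∀ s : Set X, Convex ℝ s → IsSequentiallyOpen 𝓢.gamma s → IsOpen[𝓢.gamma] s

/-- Locally `τ_X`-bi-continuous semigroups. -/
structure IsLocallyBicontinuousSemigroup {𝕜 X : Type*} [RCLike 𝕜] [NormedAddCommGroup X]
    [NormedSpace 𝕜 X] [NormedSpace ℝ X] (𝓢 : SaksSpace 𝕜 X) (S : ℝ≥0 → X →L[𝕜] X) : Prop where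
  map_zero : S 0 = ContinuousLinearMap.id 𝕜 X
  map_add : ∀ s t, S (s + t) = (S s).comp (S t)
  exponentially_bounded : ∃ M : ℝ, 1 ≤ M ∧ ∃ ω : ℝ, ∀ t : ℝ≥0, ‖S t‖ ≤ M * Real.exp (ω * t)
  strongly_continuous : ∀ x : X, Continuous[inferInstance, 𝓢.tau] fun t => S t x
  locally_bi_equicontinuous : ∀ (x : ℕ → X) (a : X), BddAbove (range fun n => ‖x n‖) →
    Tendsto x atTop (@nhds X 𝓢.tau a) →
    ∀ t₀ : ℝ≥0, ∀ V ∈ @nhds X 𝓢.tau 0, ∀ᶠ n in atTop, ∀ t ≤ t₀, S t (x n - a) ∈ V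

/-- `B` is `τ_U`-`τ_X`-continuous on norm-bounded sets. -/
def ContinuousOnBounded {𝕜 U X : Type*} [RCLike 𝕜] [NormedAddCommGroup U] [NormedSpace 𝕜 U]
    [NormedSpace ℝ U] [NormedAddCommGroup X] [NormedSpace 𝕜 X] [NormedSpace ℝ X]
    (𝓢U : SaksSpace 𝕜 U) (𝓢X : SaksSpace 𝕜 X) (B : U →L[𝕜] X) : Prop :=
  ∀ M : Set U, Bornology.IsBounded M → @ContinuousOn U X 𝓢U.tau 𝓢X.tau B M

/-- A family `(F_t)_{t ≥ 0}` of linear maps is quasi-`tU`-`tX`-equicontinuous if for some real `α`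
the family `(e^{-αt} F_t)_{t ≥ 0}` is equicontinuous for the linear topologies `tU` and `tX`. -/
def QuasiEquicontinuous {𝕜 U X : Type*} [RCLike 𝕜] [AddCommGroup U] [Module 𝕜 U]
    [AddCommGroup X] [Module 𝕜 X] (tU : TopologicalSpace U) (tX : TopologicalSpace X)
    (F : ℝ≥0 → U →ₗ[𝕜] X) : Prop :=
  ∃ α : ℝ, ∀ V ∈ @nhds X tX 0, ∃ W ∈ @nhds U tU 0,
    ∀ (t : ℝ≥0), ∀ u ∈ W, ((Real.exp (-α * t) : ℝ) : 𝕜) • F t u ∈ V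

/-- `C_{τ,b}([0,T];U)`: the bounded functions `[0,T] → U` (with the supremum norm) which are
continuous into `(U, τ_U)`. -/
def Ctb {𝕜 U : Type*} [RCLike 𝕜] [NormedAddCommGroup U] [NormedSpace 𝕜 U] [NormedSpace ℝ U]
    (𝓢 : SaksSpace 𝕜 U) (T : ℝ) : Submodule 𝕜 (lp (fun _ : Icc (0 : ℝ) T => U) ∞) where
  carrier := {f | Continuous[inferInstance, 𝓢.tau] fun t : Icc (0 : ℝ) T => f t}
  zero_mem' := @continuous_const _ _ _ 𝓢.tau 0
  add_mem' {f g} hf hg := by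
    let _ := 𝓢.tau
    have := 𝓢.topologicalAddGroup
    exact Continuous.add (f := fun t => f t) (g := fun t => g t) hf hg
  smul_mem' c f hf := by
    let _ := 𝓢.tau
    have := 𝓢.continuousSMul
    exact Continuous.const_smul (g := fun t => f t) hf c

/-- Evaluation at `t`. -/
def Ctb.eval {𝕜 U : Type*} [RCLike 𝕜] [NormedAddCommGroup U] [NormedSpace 𝕜 U] [NormedSpace ℝ U]
    (𝓢 : SaksSpace 𝕜 U) (T : ℝ) (t : Icc (0 : ℝ) T) : Ctb 𝓢 T →ₗ[𝕜] U where
  toFun f := (f : lp (fun _ : Icc (0 : ℝ) T => U) ∞) t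
  map_add' _ _ := rfl
  map_smul' _ _ := rfl

/-- The seminorm `f ↦ sup_{t ∈ [0,T]} p(f(t))`, for seminorms `p` that are continuous for the
norm. -/
noncomputable def Ctb.supSeminorm {𝕜 U : Type*} [RCLike 𝕜] [NormedAddCommGroup U]
    [NormedSpace 𝕜 U] [NormedSpace ℝ U] (𝓢 : SaksSpace 𝕜 U) (T : ℝ) (p : Seminorm 𝕜 U) :
    Seminorm 𝕜 (Ctb 𝓢 T) :=
  ⨆ t : Icc (0 : ℝ) T, p.comp (Ctb.eval 𝓢 T t)

theorem SaksSpace.norm_le_gamma {𝕜 U : Type*} [RCLike 𝕜] [NormedAddCommGroup U]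
    [NormedSpace 𝕜 U] [NormedSpace ℝ U] (𝓢 : SaksSpace 𝕜 U) : normTopology U ≤ 𝓢.gamma :=
  le_sInf fun _ ht => ht.2.2.2.1

theorem Ctb.supSeminorm_apply {𝕜 U : Type*} [RCLike 𝕜] [NormedAddCommGroup U]
    [NormedSpace 𝕜 U] [NormedSpace ℝ U] (𝓢 : SaksSpace 𝕜 U) (T : ℝ) (p : Seminorm 𝕜 U)
    (hp : Continuous[𝓢.gamma, inferInstance] p) (f : Ctb 𝓢 T) :
    Ctb.supSeminorm 𝓢 T p f = ⨆ t, p (Ctb.eval 𝓢 T t f) := by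
  have hp' : Continuous p := continuous_le_dom 𝓢.norm_le_gamma hp
  obtain ⟨C, hC0, hC⟩ := Seminorm.bound_of_continuous_normedSpace p hp'
  have hb : BddAbove (range fun t : Icc (0 : ℝ) T => p.comp (Ctb.eval 𝓢 T t)) := by
    rw [Seminorm.bddAbove_range_iff]
    intro g
    refine ⟨C * ‖(g : lp (fun _ : Icc (0 : ℝ) T => U) ∞)‖, ?_⟩
    rintro _ ⟨t, rfl⟩
    have hgt : ‖Ctb.eval 𝓢 T t g‖ ≤ ‖(g : lp (fun _ : Icc (0 : ℝ) T => U) ∞)‖ :=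
      lp.norm_apply_le_norm (E := fun _ : Icc (0 : ℝ) T => U) ENNReal.top_ne_zero _ _
    exact (hC _).trans (mul_le_mul_of_nonneg_left hgt hC0.le)
  exact Seminorm.iSup_apply hb

/-- The locally convex topology `γ_∞` on `C_{τ,b}([0,T];U)`, generated by the seminorms
`f ↦ sup_{t ∈ [0,T]} p(f(t))` where `p` runs through the `γ_U`-continuous seminorms. -/
noncomputable def gammaInfty {𝕜 U : Type*} [RCLike 𝕜] [NormedAddCommGroup U] [NormedSpace 𝕜 U]
    [NormedSpace ℝ U] (𝓢 : SaksSpace 𝕜 U) (T : ℝ) : TopologicalSpace (Ctb 𝓢 T) :=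
  (SeminormFamily.moduleFilterBasis (𝕜 := 𝕜)
    (fun p : {p : Seminorm 𝕜 U // Continuous[𝓢.gamma, inferInstance] p} =>
      Ctb.supSeminorm 𝓢 T p.1)).topology

/-- `x` is the `t`-Pettis integral of `f` with respect to `μ`: for each `t`-continuous linear
functional `x'`, the scalar function `x' ∘ f` is integrable, with integral `x' x`. -/
def HasPettisIntegral (𝕜 : Type*) {Ω X : Type*} [RCLike 𝕜] [AddCommGroup X] [Module 𝕜 X]
    [MeasurableSpace Ω] (t : TopologicalSpace X) (μ : Measure Ω) (f : Ω → X) (x : X) : Prop :=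
  ∀ x' : X →ₗ[𝕜] 𝕜, Continuous[t, inferInstance] x' →
    Integrable (fun ω => x' (f ω)) μ ∧ ∫ ω, x' (f ω) ∂μ = x' x

open Classical in
/-- The `t`-Pettis integral of `f`; it is `0` if `f` is not `t`-Pettis integrable. -/
noncomputable def pettisIntegral (𝕜 : Type*) {Ω X : Type*} [RCLike 𝕜] [AddCommGroup X]
    [Module 𝕜 X] [MeasurableSpace Ω] (t : TopologicalSpace X) (μ : Measure Ω) (f : Ω → X) : X :=
  if h : ∃ x, HasPettisIntegral 𝕜 t μ f x then h.choose else 0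

/-- Lebesgue measure on `[0,T]`. -/
noncomputable def lebesgueIcc (T : ℝ) : Measure (Icc (0 : ℝ) T) :=
  (volume : Measure ℝ).comap Subtype.val

/-- The integrand `t ↦ S_{T-t} B u(t)` on `[0,T]`. -/
noncomputable def inputIntegrand {𝕜 U X : Type*} [RCLike 𝕜] [NormedAddCommGroup U] [NormedSpace 𝕜 U]
    [NormedSpace ℝ U] [NormedAddCommGroup X] [NormedSpace 𝕜 X]
    (𝓢U : SaksSpace 𝕜 U) (S : ℝ≥0 → X →L[𝕜] X) (B : U →L[𝕜] X) (T : ℝ) (u : Ctb 𝓢U T) :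
    Icc (0 : ℝ) T → X :=
  fun t => S ⟨T - t, sub_nonneg.2 t.2.2⟩ (B (Ctb.eval 𝓢U T t u))

/-- The input map `𝓑^T u = ∫_0^T S_{T-t} B u(t) dt` as a `τ_X`-Pettis integral with respect to
Lebesgue measure on `[0,T]`. -/
noncomputable def inputMap {𝕜 U X : Type*} [RCLike 𝕜] [NormedAddCommGroup U] [NormedSpace 𝕜 U]
    [NormedSpace ℝ U] [NormedAddCommGroup X] [NormedSpace 𝕜 X] [NormedSpace ℝ X]
    (𝓢U : SaksSpace 𝕜 U) (𝓢X : SaksSpace 𝕜 X) (S : ℝ≥0 → X →L[𝕜] X) (B : U →L[𝕜] X) (T : ℝ)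
    (u : Ctb 𝓢U T) : X :=
  pettisIntegral 𝕜 𝓢X.tau (lebesgueIcc T) (inputIntegrand 𝓢U S B T u)

/-- `X°`: the bounded linear functionals which are sequentially `τ_X`-continuous on norm-bounded
sets. -/
def SaksSpace.circDual {𝕜 X : Type*} [RCLike 𝕜] [NormedAddCommGroup X] [NormedSpace 𝕜 X]
    [NormedSpace ℝ X] (𝓢 : SaksSpace 𝕜 X) : Set (X →L[𝕜] 𝕜) :=
  {x' | ∀ (x : ℕ → X) (a : X), BddAbove (range fun n => ‖x n‖) →
    Tendsto x atTop (@nhds X 𝓢.tau a) → Tendsto (fun n => x' (x n)) atTop (𝓝 (x' a))}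

end SaksControl

/-
The mixed topology is locally convex: by Wiweger's construction its neighbourhoods of zero contain
sets of finite sums of points of `p k`-balls cut down to the norm balls of radius `k + 1`. Its dual
is a norming subspace of `X'` that is closed for the norm, so by the Banach–Steinhaus theorem
`γ`-convergent sequences are norm bounded. In a C-sequential space a supremum of seminorms is
therefore `γ`-continuous as soon as it tends to zero along bounded `τ`-null sequences. For
`sup_t e^{-αt} q(S_t x)` exponential decay in norm handles large times and local
bi-equicontinuity the compact time intervals.

Sampling the integrand at simple approximations of the identity of `[0,T]` gives Bochner
integrable functions whose integrals are `γ`-Cauchy by dominated convergence; their limit is the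
Pettis integral, and a Hahn–Banach functional dominated by a seminorm `q` bounds `q` of it by the
integral of a bound for `q` of the integrand.
-/

namespace SaksControl

theorem eventually_norm_le_add_one {E : Type*} [SeminormedAddGroup E] (a : E) :
    ∀ᶠ x in 𝓝 a, ‖x‖ ≤ ‖a‖ + 1 :=
  continuous_norm.continuousAt.eventually_le_const (lt_add_one ‖a‖)

theorem tendsto_zero_of_forall_eventually_le {ι : Type*} {l : Filter ι} {f : ι → ℝ}
    (h0 : ∀ i, 0 ≤ f i) (h : ∀ ε > 0, ∀ᶠ i in l, f i ≤ ε) : Tendsto f l (𝓝 0) := by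
  refine tendsto_order.2 ⟨fun a ha => .of_forall fun i => ha.trans_le (h0 i), fun a ha => ?_⟩
  filter_upwards [h (a / 2) (half_pos ha)] with i hi using hi.trans_lt (half_lt_self ha)

theorem banach_steinhaus_of_isClosed {𝕜 E F ι : Type*} [NontriviallyNormedField 𝕜]
    [NormedAddCommGroup E] [NormedSpace 𝕜 E] [CompleteSpace E] [NormedAddCommGroup F]
    [NormedSpace 𝕜 F] {Φ : Submodule 𝕜 E} (hΦ : IsClosed (Φ : Set E)) {J : ι → E →L[𝕜] F}
    (hJ : ∀ φ ∈ Φ, ∃ C, ∀ i, ‖J i φ‖ ≤ C) :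
    ∃ C, 0 ≤ C ∧ ∀ i, ∀ φ ∈ Φ, ‖J i φ‖ ≤ C * ‖φ‖ := by
  have : CompleteSpace Φ := hΦ.completeSpace_coe
  let JΦ (i : ι) : Φ →L[𝕜] F := (J i).comp Φ.subtypeL
  have hJΦ (φ : Φ) : ∃ C, ∀ i, ‖JΦ i φ‖ ≤ C := hJ φ φ.2
  obtain ⟨C, hC⟩ := banach_steinhaus hJΦ
  exact ⟨|C|, abs_nonneg C, fun i φ hφ =>
    (JΦ i).le_of_opNorm_le ((hC i).trans (le_abs_self C)) ⟨φ, hφ⟩⟩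

section Polynormable

variable {𝕜 E : Type*} [RCLike 𝕜] [AddCommGroup E] [Module 𝕜 E]
  {t : TopologicalSpace E}

theorem tendsto_seminorm_nhds_zero {q : Seminorm 𝕜 E} (hq : Continuous q) :
    Tendsto q (𝓝 0) (𝓝 0) :=
  hq.tendsto' 0 0 (map_zero q)

theorem exists_seminorm_ball_subset [PolynormableSpace 𝕜 E] {V : Set E} (hV : V ∈ 𝓝 (0 : E)) :
    ∃ q : Seminorm 𝕜 E, Continuous q ∧ q.ball 0 1 ⊆ V := by
  have hE := PolynormableSpace.withSeminorms 𝕜 E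
  have := hE.topologicalAddGroup
  obtain ⟨s, r, hr, hs⟩ := (hE.mem_nhds_iff 0 V).1 hV
  let p : Seminorm 𝕜 E := s.sup fun p => p.1
  have hp : Continuous p := Seminorm.continuous_finsetSup fun p _ => p.2
  refine ⟨r⁻¹.toNNReal • p, hp.const_smul r⁻¹.toNNReal, fun x hx => hs ?_⟩
  rw [Seminorm.mem_ball_zero, smul_apply, NNReal.smul_def, smul_eq_mul,
    Real.coe_toNNReal _ (inv_pos.2 hr).le, inv_mul_lt_one₀ hr] at hx
  rwa [Seminorm.mem_ball_zero]

theorem polynormableSpace_of_exists_seminorm [IsTopologicalAddGroup E]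
    (h : ∀ V ∈ 𝓝 (0 : E), ∃ q : Seminorm 𝕜 E, Continuous q ∧ q.ball 0 1 ⊆ V) :
    PolynormableSpace 𝕜 E where
  withSeminorms' := by
    refine (SeminormFamily.withSeminorms_iff_nhds_eq_iInf _).2 (le_antisymm ?_ fun V hV => ?_)
    · refine le_iInf fun p => tendsto_iff_comap.1 ?_
      simpa only [map_zero] using p.2.tendsto 0
    · obtain ⟨q, hq, hqV⟩ := h V hV
      refine mem_of_superset (mem_iInf_of_mem ⟨q, hq⟩ (preimage_mem_comap (Iio_mem_nhds one_pos)))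
        fun x hx => hqV ?_
      rwa [Seminorm.mem_ball_zero]

open scoped ComplexOrder in
theorem polynormableSpace_of_locallyConvexSpace_real [Module ℝ E] [IsScalarTower ℝ 𝕜 E]
    [IsTopologicalAddGroup E] [ContinuousSMul 𝕜 E] [LocallyConvexSpace ℝ E] :
    PolynormableSpace 𝕜 E := by
  have : ContinuousSMul ℝ E := IsScalarTower.continuousSMul 𝕜
  have : LocallyConvexSpace 𝕜 E :=
    .ofBasisZero 𝕜 E _ _ (LocallyConvexSpace.convex_basis_zero ℝ E) fun _ hs =>
      convex_of_nonneg_surjective_algebraMap _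
        (fun _ => RCLike.nonneg_iff_exists_ofReal.mp) hs.2
  infer_instance

theorem tendsto_nhds_iff_forall_seminorm [PolynormableSpace 𝕜 E] {ι : Type*} {l : Filter ι}
    {x : ι → E} {a : E} :
    Tendsto x l (𝓝 a) ↔
      ∀ q : Seminorm 𝕜 E, Continuous q → Tendsto (fun i => q (x i - a)) l (𝓝 0) := by
  have hE := PolynormableSpace.withSeminorms 𝕜 E
  have := hE.topologicalAddGroup
  rw [← tendsto_sub_nhds_zero_iff, (SeminormFamily.withSeminorms_iff_nhds_eq_iInf _).1 hE]
  simp only [tendsto_iInf, tendsto_comap_iff, Subtype.forall, Function.comp_def]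

theorem exists_linearMap_apply_eq_seminorm (q : Seminorm 𝕜 E) (x : E) :
    ∃ φ : E →ₗ[𝕜] 𝕜, φ x = (q x : 𝕜) ∧ ∀ y, ‖φ y‖ ≤ q y := by
  rcases eq_or_ne x 0 with rfl | hx
  · exact ⟨0, by simp, fun y => by simp⟩
  let φ : Module.Dual 𝕜 (Submodule.span 𝕜 {x}) :=
    (q x : 𝕜) • (LinearEquiv.coord 𝕜 E x hx).toLinearMap
  have hφ (y : Submodule.span 𝕜 {x}) : ‖φ y‖ ≤ q y := by
    calc ‖φ y‖ = q (LinearEquiv.coord 𝕜 E x hx y • x) := by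
          rw [LinearMap.smul_apply, smul_eq_mul, norm_mul, RCLike.norm_ofReal,
            abs_of_nonneg (apply_nonneg q x), map_smul_eq_mul, mul_comm, LinearEquiv.coe_coe]
      _ ≤ q y := by rw [LinearEquiv.coord_apply_smul]
  obtain ⟨ψ, hψφ, hψ⟩ := φ.exists_extension_of_le_seminorm _ hφ
  refine ⟨ψ, ?_, hψ⟩
  rw [hψφ ⟨x, Submodule.mem_span_singleton_self x⟩, LinearMap.smul_apply, LinearEquiv.coe_coe,
    LinearEquiv.coord_self, smul_eq_mul, mul_one]

theorem continuous_of_norm_le_seminorm [IsTopologicalAddGroup E] {φ : E →ₗ[𝕜] 𝕜}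
    {q : Seminorm 𝕜 E} (hq : Continuous q) (hφ : ∀ x, ‖φ x‖ ≤ q x) : Continuous φ :=
  continuous_of_continuousAt_zero φ <| by
    rw [ContinuousAt, map_zero]
    exact squeeze_zero_norm hφ (tendsto_seminorm_nhds_zero hq)

theorem continuous_of_forall_seminorm_le [IsTopologicalAddGroup E] {F : Type*} [AddCommGroup F]
    [Module 𝕜 F] {s : TopologicalSpace F} [IsTopologicalAddGroup F] [PolynormableSpace 𝕜 F]
    {L : E →ₗ[𝕜] F}
    (hL : ∀ q : Seminorm 𝕜 F, Continuous q →
      ∃ p : Seminorm 𝕜 E, Continuous p ∧ ∃ C : ℝ, ∀ x, q (L x) ≤ C * p x) : Continuous L :=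
  continuous_of_continuousAt_zero L <| by
    rw [ContinuousAt, map_zero, tendsto_nhds_iff_forall_seminorm (𝕜 := 𝕜)]
    intro q hq
    obtain ⟨p, hp, C, hC⟩ := hL q hq
    simp only [sub_zero]
    exact squeeze_zero (fun x => apply_nonneg q _) hC
      (by simpa using (tendsto_seminorm_nhds_zero hp).const_mul C)

end Polynormable

section Sums

open scoped Pointwise

variable {E : Type*}

theorem exists_seq_add_subset [AddMonoid E] {t : TopologicalSpace E} [ContinuousAdd E] {V : Set E}
    (hV : V ∈ 𝓝 (0 : E)) :
    ∃ W : ℕ → Set E, W 0 = V ∧ (∀ k, W k ∈ 𝓝 0) ∧ ∀ k, W (k + 1) + W (k + 1) ⊆ W k := by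
  have halve (A : {A : Set E // A ∈ 𝓝 0}) : ∃ A' : {A : Set E // A ∈ 𝓝 0}, A'.1 + A'.1 ⊆ A.1 :=
    let ⟨O, hO, h0, h⟩ := exists_open_nhds_zero_add_subset A.2
    ⟨⟨O, hO.mem_nhds h0⟩, h⟩
  choose half h_half using halve
  refine ⟨fun k => (half^[k] ⟨V, hV⟩).1, rfl, fun k => (half^[k] ⟨V, hV⟩).2, fun k => ?_⟩
  simp only [Function.iterate_succ_apply']
  exact h_half _

theorem sum_range_add_subset [AddCommMonoid E] {W : ℕ → Set E}
    (hW : ∀ k, W (k + 1) + W (k + 1) ⊆ W k) (n : ℕ) :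
    ∑ k ∈ Finset.range n, W (k + 1) + W n ⊆ W 0 := by
  induction n with
  | zero => simp
  | succ n ih =>
    rw [Finset.sum_range_succ, add_assoc]
    exact (add_subset_add_left (hW n)).trans ih

/-- The union of the finite sums `K 0 + ⋯ + K (n - 1)`, from which Wiweger builds the
neighbourhoods of zero of a mixed topology. -/
def finiteSums [AddCommMonoid E] (K : ℕ → Set E) : Set E :=
  ⋃ n, ∑ k ∈ Finset.range n, K k

section AddCommMonoid

variable [AddCommMonoid E] {K : ℕ → Set E}

theorem monotone_sum_range (hK : ∀ k, 0 ∈ K k) : Monotone fun n => ∑ k ∈ Finset.range n, K k :=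
  monotone_nat_of_le_succ fun n => by
    rw [Finset.sum_range_succ]
    exact subset_add_left _ (hK n)

theorem subset_finiteSums (hK : ∀ k, 0 ∈ K k) (n : ℕ) : K n ⊆ finiteSums K := by
  refine Subset.trans ?_ (subset_iUnion _ (n + 1))
  rw [Finset.sum_range_succ]
  refine subset_add_right _ (?_ : (0 : E) ∈ _)
  simpa using finsetSum_mem_finsetSum (Finset.range n) K (fun _ => 0) fun k _ => hK k

theorem finiteSums_subset {W : ℕ → Set E} (h0 : ∀ k, 0 ∈ W k)
    (hW : ∀ k, W (k + 1) + W (k + 1) ⊆ W k) (hKW : ∀ k, K k ⊆ W (k + 1)) :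
    finiteSums K ⊆ W 0 :=
  iUnion_subset fun n => calc
    ∑ k ∈ Finset.range n, K k ⊆ ∑ k ∈ Finset.range n, W (k + 1) :=
      finsetSum_subset_finsetSum _ _ _ fun k _ => hKW k
    _ ⊆ ∑ k ∈ Finset.range n, W (k + 1) + W n := subset_add_left _ (h0 n)
    _ ⊆ W 0 := sum_range_add_subset hW n

end AddCommMonoid

theorem convex_finiteSums {R : Type*} [Semiring R] [PartialOrder R] [AddCommGroup E] [Module R E]
    {K : ℕ → Set E} (h0 : ∀ k, 0 ∈ K k) (hK : ∀ k, Convex R (K k)) : Convex R (finiteSums K) :=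
  (monotone_sum_range h0).directed_le.convex_iUnion fun _ => convex_sum _ fun k _ => hK k

theorem balanced_finiteSums {R : Type*} [SeminormedRing R] [AddCommGroup E] [Module R E]
    {K : ℕ → Set E} (hK : ∀ k, Balanced R (K k)) : Balanced R (finiteSums K) :=
  balanced_iUnion fun n => by
    induction n with
    | zero => simpa using balanced_zero
    | succ n ih => rw [Finset.sum_range_succ]; exact ih.add (hK n)

end Sums

namespace SaksSpace

section MixedTopology

variable {𝕜 X : Type*} [RCLike 𝕜] [NormedAddCommGroup X] [NormedSpace 𝕜 X] [NormedSpace ℝ X]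
  (𝓢 : SaksSpace 𝕜 X)

theorem gamma_mem_mixedCandidates : 𝓢.gamma ∈ mixedCandidates 𝕜 𝓢.tau :=
  (isLeast_mixedTopology 𝕜 𝓢.tau 𝓢.topologicalAddGroup 𝓢.continuousSMul 𝓢.norm_le_tau).1

instance isTopologicalAddGroup_tau : @IsTopologicalAddGroup X 𝓢.tau _ :=
  𝓢.topologicalAddGroup

instance continuousSMul_tau : @ContinuousSMul 𝕜 X _ _ 𝓢.tau :=
  𝓢.continuousSMul

instance isTopologicalAddGroup_gamma : @IsTopologicalAddGroup X 𝓢.gamma _ :=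
  𝓢.gamma_mem_mixedCandidates.1

instance continuousSMul_gamma : @ContinuousSMul 𝕜 X _ _ 𝓢.gamma :=
  𝓢.gamma_mem_mixedCandidates.2.1

theorem gamma_le_tau : 𝓢.gamma ≤ 𝓢.tau :=
  𝓢.gamma_mem_mixedCandidates.2.2.1

/-- The `τ`-neighbourhoods of zero relative to the closed ball of radius `R`. A linear map is
continuous for the mixed topology as soon as it tends to zero along all these filters, see
`continuous_gamma_of_tendsto`. -/
def nhdsInBall (R : ℝ) : Filter X :=
  @nhdsWithin X 𝓢.tau 0 (Metric.closedBall 0 R)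

theorem tendsto_nhdsInBall {ι : Type*} {l : Filter ι} {x : ι → X} {R : ℝ} :
    Tendsto x l (𝓢.nhdsInBall R) ↔ Tendsto x l (@nhds X 𝓢.tau 0) ∧ ∀ᶠ i in l, ‖x i‖ ≤ R := by
  simp only [nhdsInBall, nhdsWithin, tendsto_inf, tendsto_principal, mem_closedBall_zero_iff]

theorem nhdsInBall_le_nhds_gamma (R : ℝ) : 𝓢.nhdsInBall R ≤ @nhds X 𝓢.gamma 0 := by
  let b := Metric.closedBall (0 : X) |R|
  let z : b := ⟨0, Metric.mem_closedBall_self (abs_nonneg R)⟩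
  have hb : 𝓢.gamma.induced ((↑) : b → X) = 𝓢.tau.induced (↑) :=
    𝓢.gamma_mem_mixedCandidates.2.2.2.2 b Metric.isBounded_closedBall
  calc 𝓢.nhdsInBall R ≤ @nhdsWithin X 𝓢.tau 0 b :=
        inf_le_inf_left _ (principal_mono.2 (Metric.closedBall_subset_closedBall (le_abs_self R)))
    _ = map (↑) (@nhds b (𝓢.tau.induced (↑)) z) := (@map_nhds_subtype_val X 𝓢.tau b z).symm
    _ = map (↑) (@nhds b (𝓢.gamma.induced (↑)) z) := by rw [hb]
    _ = @nhdsWithin X 𝓢.gamma 0 b := @map_nhds_subtype_val X 𝓢.gamma b z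
    _ ≤ @nhds X 𝓢.gamma 0 := inf_le_left

variable {𝓢}

theorem tendsto_of_nhdsInBall_le {t : TopologicalSpace X} [IsTopologicalAddGroup X]
    (ht : ∀ R, 𝓢.nhdsInBall R ≤ 𝓝 0) {ι : Type*} {l : Filter ι} {x : ι → X} {a : X} {R : ℝ}
    (hR : ∀ᶠ i in l, ‖x i‖ ≤ R) (hx : Tendsto x l (@nhds X 𝓢.tau a)) : Tendsto x l (𝓝 a) := by
  rw [← tendsto_sub_nhds_zero_iff]
  refine (𝓢.tendsto_nhdsInBall.2 ⟨?_, hR.mono fun i hi => ?_⟩).mono_right (ht (R + ‖a‖))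
  · exact (@tendsto_sub_nhds_zero_iff X _ 𝓢.tau _ _ _ _ _).2 hx
  · exact (norm_sub_le _ _).trans (add_le_add_left hi _)

theorem tendsto_gamma {ι : Type*} {l : Filter ι} {x : ι → X} {a : X} {R : ℝ}
    (hR : ∀ᶠ i in l, ‖x i‖ ≤ R) (hx : Tendsto x l (@nhds X 𝓢.tau a)) :
    Tendsto x l (@nhds X 𝓢.gamma a) :=
  tendsto_of_nhdsInBall_le 𝓢.nhdsInBall_le_nhds_gamma hR hx

theorem gamma_le_of_nhdsInBall_le {t : TopologicalSpace X} [IsTopologicalAddGroup X]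
    [ContinuousSMul 𝕜 X] (ht : ∀ R, 𝓢.nhdsInBall R ≤ 𝓝 0) : 𝓢.gamma ≤ t := by
  suffices h : 𝓢.tau ⊓ t ∈ mixedCandidates 𝕜 𝓢.tau from (sInf_le h).trans inf_le_right
  refine ⟨topologicalAddGroup_inf 𝓢.topologicalAddGroup ‹_›,
    @continuousSMul_inf 𝕜 X _ _ _ _ 𝓢.continuousSMul ‹_›, inf_le_left,
    le_inf 𝓢.norm_le_tau (le_of_nhds_le_nhds fun a => ?_), fun s hs => ?_⟩
  · exact tendsto_of_nhdsInBall_le ht (eventually_norm_le_add_one a) (nhds_mono 𝓢.norm_le_tau)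
  · obtain ⟨R, hR⟩ := hs.exists_norm_le
    rw [induced_inf, inf_eq_left]
    refine le_of_nhds_le_nhds fun a => ?_
    rw [@nhds_induced _ _ 𝓢.tau, @nhds_induced _ _ t, ← tendsto_iff_comap]
    exact tendsto_of_nhdsInBall_le ht (Eventually.of_forall fun x => hR x x.2) tendsto_comap

theorem continuous_gamma_of_tendsto {Y : Type*} [AddCommGroup Y] [Module 𝕜 Y]
    {t : TopologicalSpace Y} [IsTopologicalAddGroup Y] [ContinuousSMul 𝕜 Y] {F : X →ₗ[𝕜] Y}
    (hF : ∀ R, Tendsto F (𝓢.nhdsInBall R) (𝓝 0)) : Continuous[𝓢.gamma, t] F := by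
  rw [continuous_iff_le_induced]
  have := topologicalAddGroup_induced F
  have := continuousSMul_induced F
  refine gamma_le_of_nhdsInBall_le (t := .induced F t) fun R => ?_
  rw [nhds_induced, map_zero]
  exact (hF R).le_comap

theorem continuous_gamma_seminorm_of_tendsto {q : Seminorm 𝕜 X}
    (hq : ∀ R, Tendsto q (𝓢.nhdsInBall R) (𝓝 0)) : Continuous[𝓢.gamma, inferInstance] q := by
  let Q : SeminormFamily 𝕜 X Unit := fun _ => q
  let t : TopologicalSpace X := Q.moduleFilterBasis.topology
  have hQ : WithSeminorms Q := ⟨rfl⟩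
  have := hQ.topologicalAddGroup
  have := hQ.continuousSMul
  have ht (R : ℝ) : 𝓢.nhdsInBall R ≤ 𝓝 0 := by
    rw [(Q.withSeminorms_iff_nhds_eq_iInf).1 hQ]
    exact le_iInf fun _ => (hq R).le_comap
  exact continuous_le_dom (gamma_le_of_nhdsInBall_le ht) (hQ.continuous_seminorm ())

end MixedTopology

section LocallyConvex

variable {𝕜 X : Type*} [RCLike 𝕜] [NormedAddCommGroup X] [NormedSpace 𝕜 X] [NormedSpace ℝ X]
  [IsScalarTower ℝ 𝕜 X] (𝓢 : SaksSpace 𝕜 X)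

instance polynormableSpace_tau : @PolynormableSpace 𝕜 X _ _ _ 𝓢.tau :=
  have := 𝓢.locallyConvex
  polynormableSpace_of_locallyConvexSpace_real

theorem exists_continuous_gamma_ball_subset_finiteSums {p : ℕ → Seminorm 𝕜 X}
    (hp : ∀ k, Continuous[𝓢.tau, inferInstance] (p k)) :
    ∃ q : Seminorm 𝕜 X, Continuous[𝓢.gamma, inferInstance] q ∧
      q.ball 0 1 ⊆ finiteSums fun k : ℕ => (p k).ball 0 1 ∩ Metric.closedBall 0 (k + 1) := by
  set K : ℕ → Set X := fun k => (p k).ball 0 1 ∩ Metric.closedBall 0 (k + 1)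
  have hK0 (k : ℕ) : (0 : X) ∈ K k := ⟨by simp, Metric.mem_closedBall_self (by positivity)⟩
  have hKmem : K 0 ∈ 𝓝 (0 : X) := by
    have hp0 : Continuous (p 0) := continuous_le_dom 𝓢.norm_le_tau (hp 0)
    exact inter_mem (Seminorm.ball_mem_nhds hp0 one_pos)
      (Metric.closedBall_mem_nhds _ (by positivity))
  have hbal : Balanced 𝕜 (finiteSums K) :=
    balanced_finiteSums fun k => ((p k).balanced_ball_zero 1).inter balanced_closedBall_zero
  have hconv : Convex ℝ (finiteSums K) :=
    convex_finiteSums hK0 fun k => ((p k).convex_ball 0 1).inter (convex_closedBall 0 _)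
  have habs : Absorbent ℝ (finiteSums K) :=
    absorbent_nhds_zero (mem_of_superset hKmem (subset_finiteSums hK0 0))
  refine ⟨gaugeSeminorm hbal hconv habs, continuous_gamma_seminorm_of_tendsto fun R =>
    tendsto_zero_of_forall_eventually_le (apply_nonneg _) fun ε hε => ?_, fun x hx => ?_⟩
  · obtain ⟨k, hk⟩ := exists_nat_ge (ε⁻¹ * R)
    have hpk : ∀ᶠ x in 𝓢.nhdsInBall R, p k x < ε :=
      ((tendsto_seminorm_nhds_zero (hp k)).mono_left inf_le_left).eventually_lt_const hε
    filter_upwards [hpk, (𝓢.tendsto_nhdsInBall.1 tendsto_id).2] with x hx hxR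
    have hmem : ε⁻¹ • x ∈ K k := by
      rw [RCLike.real_smul_eq_coe_smul (K := 𝕜)]
      refine ⟨?_, ?_⟩
      · rw [Seminorm.mem_ball_zero, map_smul_eq_mul, RCLike.norm_ofReal,
          abs_of_pos (inv_pos.2 hε), inv_mul_lt_one₀ hε]
        exact hx
      · rw [mem_closedBall_zero_iff, norm_smul, RCLike.norm_ofReal, abs_of_pos (inv_pos.2 hε)]
        have : ε⁻¹ * ‖x‖ ≤ ε⁻¹ * R := by gcongr; exact hxR
        linarith
    exact gauge_le_of_mem hε.le
      ((mem_smul_set_iff_inv_smul_mem₀ hε.ne' _ _).2 (subset_finiteSums hK0 k hmem))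
  · exact setOfPred_gauge_lt_one_subset_self hconv (subset_finiteSums hK0 0 (hK0 0)) habs
      (by simpa [Seminorm.mem_ball_zero] using hx)

instance polynormableSpace_gamma : @PolynormableSpace 𝕜 X _ _ _ 𝓢.gamma := by
  refine polynormableSpace_of_exists_seminorm fun V hV => ?_
  obtain ⟨W, rfl, hW, hWadd⟩ := exists_seq_add_subset hV
  have hball (k : ℕ) : ∃ p : Seminorm 𝕜 X, Continuous[𝓢.tau, inferInstance] p ∧
      p.ball 0 1 ∩ Metric.closedBall 0 (k + 1) ⊆ W (k + 1) := by
    obtain ⟨O, hO, hOW⟩ := (@mem_nhdsWithin_iff_exists_mem_nhds_inter X 𝓢.tau _ _ _).1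
      (𝓢.nhdsInBall_le_nhds_gamma (k + 1) (hW (k + 1)))
    obtain ⟨p, hp, hpO⟩ := exists_seminorm_ball_subset (𝕜 := 𝕜) hO
    exact ⟨p, hp, (inter_subset_inter_left _ hpO).trans hOW⟩
  choose p hp hpW using hball
  obtain ⟨q, hq, hqK⟩ := 𝓢.exists_continuous_gamma_ball_subset_finiteSums hp
  have hW0 (k : ℕ) : (0 : X) ∈ W k := @mem_of_mem_nhds X 𝓢.gamma _ _ (hW k)
  exact ⟨q, hq, hqK.trans (finiteSums_subset hW0 hWadd hpW)⟩

end LocallyConvex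

section Dual

variable {𝕜 X : Type*} [RCLike 𝕜] [NormedAddCommGroup X] [NormedSpace 𝕜 X] [NormedSpace ℝ X]
  (𝓢 : SaksSpace 𝕜 X)

/-- The dual of `(X, γ)`, as a subspace of the norm dual. It is closed there, which makes the
uniform boundedness principle available for the mixed topology. -/
def mixedDual : Submodule 𝕜 (X →L[𝕜] 𝕜) where
  carrier := {φ | Continuous[𝓢.gamma, inferInstance] φ}
  zero_mem' := @continuous_const _ _ 𝓢.gamma _ 0
  add_mem' hφ hψ := @Continuous.add _ _ _ _ _ 𝓢.gamma _ _ hφ hψ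
  smul_mem' c _ hφ := @Continuous.const_smul _ _ _ _ _ _ 𝓢.gamma _ hφ c

theorem isClosed_mixedDual : IsClosed (𝓢.mixedDual : Set (X →L[𝕜] 𝕜)) := by
  refine isClosed_of_closure_subset fun φ hφ => ?_
  refine continuous_gamma_of_tendsto (F := φ.toLinearMap) fun R =>
    tendsto_zero_iff_norm_tendsto_zero.2 <|
      tendsto_zero_of_forall_eventually_le (fun _ => norm_nonneg _) fun ε hε => ?_
  obtain ⟨ψ, hψ, hφψ⟩ := Metric.mem_closure_iff.1 hφ (ε / 2 / (|R| + 1)) (by positivity)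
  have hψ0 : Tendsto (fun x => ‖ψ x‖) (𝓢.nhdsInBall R) (𝓝 0) :=
    tendsto_zero_iff_norm_tendsto_zero.1 <|
      (@Continuous.tendsto' X 𝕜 𝓢.gamma _ ψ hψ 0 0 (map_zero ψ)).mono_left
        (𝓢.nhdsInBall_le_nhds_gamma R)
  filter_upwards [hψ0.eventually_le_const (half_pos hε), (𝓢.tendsto_nhdsInBall.1 tendsto_id).2]
    with x hψx hx
  have hsub : ‖(φ - ψ) x‖ ≤ ε / 2 := calc
    ‖(φ - ψ) x‖ ≤ ‖φ - ψ‖ * ‖x‖ := (φ - ψ).le_opNorm x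
    _ ≤ ε / 2 / (|R| + 1) * (|R| + 1) := by
      rw [dist_eq_norm] at hφψ
      gcongr
      exact (hx.trans (le_abs_self R)).trans (lt_add_one _).le
    _ = ε / 2 := div_mul_cancel₀ _ (by positivity)
  calc ‖φ x‖ = ‖(φ - ψ) x + ψ x‖ := by simp
    _ ≤ ‖(φ - ψ) x‖ + ‖ψ x‖ := norm_add_le _ _
    _ ≤ ε := by linarith

variable {𝓢}

theorem norm_le_of_forall_mixedDual {x : X} {C : ℝ} (hC0 : 0 ≤ C)
    (hC : ∀ φ ∈ 𝓢.mixedDual, ‖φ x‖ ≤ C * ‖φ‖) : ‖x‖ ≤ C := by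
  refine (𝓢.norming x).2 ?_
  rintro _ ⟨φ, hφ, hφ1, rfl⟩
  let ψ : X →L[𝕜] 𝕜 := φ.mkContinuous 1 fun y => by simpa using hφ1 y
  have hψ : ‖ψ‖ ≤ 1 := φ.mkContinuous_norm_le zero_le_one _
  exact (hC ψ (continuous_le_dom 𝓢.gamma_le_tau hφ)).trans (mul_le_of_le_one_right hC0 hψ)

theorem exists_norm_le_of_forall_mixedDual {ι : Type*} {x : ι → X}
    (hx : ∀ φ ∈ 𝓢.mixedDual, ∃ C, ∀ i, ‖φ (x i)‖ ≤ C) : ∃ C, ∀ i, ‖x i‖ ≤ C := by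
  obtain ⟨C, hC0, hC⟩ := banach_steinhaus_of_isClosed 𝓢.isClosed_mixedDual
    (J := fun i => ContinuousLinearMap.apply 𝕜 𝕜 (x i)) hx
  exact ⟨C, fun i => norm_le_of_forall_mixedDual hC0 (hC i)⟩

theorem bddAbove_range_norm_of_tendsto_gamma {x : ℕ → X} {a : X}
    (hx : Tendsto x atTop (@nhds X 𝓢.gamma a)) : BddAbove (range fun n => ‖x n‖) := by
  obtain ⟨C, hC⟩ := exists_norm_le_of_forall_mixedDual (𝓢 := 𝓢) (x := x) fun φ hφ => by
    have hφx : Tendsto (fun n => ‖φ (x n)‖) atTop (𝓝 ‖φ a‖) :=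
      ((@Continuous.tendsto X 𝕜 𝓢.gamma _ _ hφ a).comp hx).norm
    simpa only [bddAbove_def, forall_mem_range] using hφx.bddAbove_range
  exact ⟨C, forall_mem_range.2 hC⟩

end Dual

section CSequential

variable {𝕜 X : Type*} [RCLike 𝕜] [NormedAddCommGroup X] [NormedSpace 𝕜 X] [NormedSpace ℝ X]
  [IsScalarTower ℝ 𝕜 X] {𝓢 : SaksSpace 𝕜 X}

theorem CSequential.continuous_seminorm (h𝓢 : 𝓢.CSequential) {q : Seminorm 𝕜 X}
    (hq : ∀ y : ℕ → X, BddAbove (range fun n => ‖y n‖) → Tendsto y atTop (@nhds X 𝓢.tau 0) →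
      Tendsto (fun n => q (y n)) atTop (𝓝 0)) :
    Continuous[𝓢.gamma, inferInstance] q := by
  have hopen : IsOpen[𝓢.gamma] (q.ball 0 1) := by
    refine h𝓢 _ (q.convex_ball 0 1) fun x a ha hx => ?_
    rw [Seminorm.mem_ball_zero] at ha
    have hxa : Tendsto (fun n => x n - a) atTop (@nhds X 𝓢.gamma 0) :=
      (@tendsto_sub_nhds_zero_iff X _ 𝓢.gamma _ _ _ _ _).2 hx
    have hqx := hq _ (bddAbove_range_norm_of_tendsto_gamma hxa)
      (hxa.mono_right (nhds_mono 𝓢.gamma_le_tau))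
    filter_upwards [hqx.eventually_lt_const (sub_pos.2 ha)] with n hn
    have hle : q (x n) ≤ q (x n - a) + q a := by
      simpa only [sub_add_cancel] using map_add_le_add q (x n - a) a
    rw [Seminorm.mem_ball_zero]
    linarith
  have := @ContinuousSMul.continuousConstSMul 𝕜 X _ 𝓢.gamma _ _
  exact @Seminorm.continuous 𝕜 X _ _ _ 𝓢.gamma _ this q 1
    (@IsOpen.mem_nhds X 𝓢.gamma _ _ hopen (by simp))

theorem CSequential.continuous_iSup_seminorm (h𝓢 : 𝓢.CSequential) {ι : Type*}
    {q : ι → Seminorm 𝕜 X} (hbdd : BddAbove (range q))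
    (hq : ∀ y : ℕ → X, BddAbove (range fun n => ‖y n‖) → Tendsto y atTop (@nhds X 𝓢.tau 0) →
      ∀ ε > 0, ∀ᶠ n in atTop, ∀ i, q i (y n) ≤ ε) :
    Continuous[𝓢.gamma, inferInstance] (⨆ i, q i : Seminorm 𝕜 X) := by
  refine h𝓢.continuous_seminorm fun y hyb hy =>
    tendsto_zero_of_forall_eventually_le (fun _ => apply_nonneg _ _) fun ε hε => ?_
  filter_upwards [hq y hyb hy ε hε] with n hn
  rw [Seminorm.iSup_apply hbdd]
  exact Real.iSup_le hn hε.le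

theorem CSequential.continuous_of_mem_circDual (h𝓢 : 𝓢.CSequential) {φ : X →L[𝕜] 𝕜}
    (hφ : φ ∈ 𝓢.circDual) : Continuous[𝓢.gamma, inferInstance] φ := by
  refine continuous_of_norm_le_seminorm (t := 𝓢.gamma) (φ := φ.toLinearMap)
    (q := (normSeminorm 𝕜 𝕜).comp φ.toLinearMap)
    (h𝓢.continuous_seminorm fun y hyb hy => ?_) fun _ => le_rfl
  simpa using (hφ y 0 hyb hy).norm

end CSequential

end SaksSpace

section BicontinuousFamily

variable {𝕜 X U : Type*} [RCLike 𝕜] [NormedAddCommGroup X] [NormedSpace 𝕜 X] [NormedSpace ℝ X]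
  [NormedAddCommGroup U] [NormedSpace 𝕜 U] [NormedSpace ℝ U] {𝓢 : SaksSpace 𝕜 X}
  {S : ℝ≥0 → X →L[𝕜] X}

/-- The analytic part of local bi-continuity for a family of bounded operators indexed by time:
exponential boundedness, strong continuity and local bi-equicontinuity, without the semigroup
law. -/
structure IsLocallyBicontinuousFamily (𝓢 : SaksSpace 𝕜 X) (S : ℝ≥0 → X →L[𝕜] X) : Prop where
  exponentially_bounded : ∃ M ω : ℝ, ∀ t : ℝ≥0, ‖S t‖ ≤ M * Real.exp (ω * t)
  strongly_continuous : ∀ x : X, Continuous[inferInstance, 𝓢.tau] fun t => S t x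
  locally_bi_equicontinuous : ∀ (x : ℕ → X) (a : X), BddAbove (range fun n => ‖x n‖) →
    Tendsto x atTop (@nhds X 𝓢.tau a) →
    ∀ t₀ : ℝ≥0, ∀ V ∈ @nhds X 𝓢.tau 0, ∀ᶠ n in atTop, ∀ t ≤ t₀, S t (x n - a) ∈ V

theorem IsLocallyBicontinuousSemigroup.isLocallyBicontinuousFamily
    (hS : IsLocallyBicontinuousSemigroup 𝓢 S) : IsLocallyBicontinuousFamily 𝓢 S where
  exponentially_bounded := hS.exponentially_bounded.imp fun _ h => h.2
  strongly_continuous := hS.strongly_continuous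
  locally_bi_equicontinuous := hS.locally_bi_equicontinuous

namespace IsLocallyBicontinuousFamily

theorem exists_exp_mul_norm_le (hS : IsLocallyBicontinuousFamily 𝓢 S) :
    ∃ α M : ℝ, 0 ≤ α ∧ 0 ≤ M ∧
      ∀ (t : ℝ≥0) (x : X), Real.exp (-α * t) * ‖S t x‖ ≤ M * Real.exp (-t) * ‖x‖ := by
  obtain ⟨M, ω, hM⟩ := hS.exponentially_bounded
  have hM0 : 0 ≤ M := by simpa using (norm_nonneg _).trans (hM 0)
  refine ⟨|ω| + 1, M, by positivity, hM0, fun t x => ?_⟩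
  calc Real.exp (-(|ω| + 1) * t) * ‖S t x‖
      ≤ Real.exp (-(|ω| + 1) * t) * (M * Real.exp (|ω| * t) * ‖x‖) := by
        gcongr
        refine (S t).le_of_opNorm_le ((hM t).trans ?_) x
        gcongr
        exact le_abs_self ω
    _ = M * (Real.exp (-(|ω| + 1) * t) * Real.exp (|ω| * t)) * ‖x‖ := by ring
    _ = M * Real.exp (-t) * ‖x‖ := by rw [← Real.exp_add]; ring_nf

theorem exists_norm_le (hS : IsLocallyBicontinuousFamily 𝓢 S) (T : ℝ) :
    ∃ C, 0 ≤ C ∧ ∀ t : ℝ≥0, t ≤ T → ‖S t‖ ≤ C := by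
  obtain ⟨M, ω, hM⟩ := hS.exponentially_bounded
  have hM0 : 0 ≤ M := by simpa using (norm_nonneg _).trans (hM 0)
  refine ⟨M * Real.exp (|ω| * T), by positivity, fun t ht => (hM t).trans ?_⟩
  gcongr
  exact le_abs_self ω

theorem eventually_seminorm_le (hS : IsLocallyBicontinuousFamily 𝓢 S) {q : Seminorm 𝕜 X}
    (hq : Continuous[𝓢.gamma, inferInstance] q) {y : ℕ → X}
    (hyb : BddAbove (range fun n => ‖y n‖)) (hy : Tendsto y atTop (@nhds X 𝓢.tau 0)) (t₀ : ℝ≥0)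
    {ε : ℝ} (hε : 0 < ε) : ∀ᶠ n in atTop, ∀ t ≤ t₀, q (S t (y n)) ≤ ε := by
  obtain ⟨R, hR⟩ := hyb
  obtain ⟨C, hC0, hC⟩ := hS.exists_norm_le t₀
  have hqε : ∀ᶠ x in 𝓢.nhdsInBall (C * R), q x ≤ ε :=
    ((tendsto_seminorm_nhds_zero hq).mono_left
      (𝓢.nhdsInBall_le_nhds_gamma _)).eventually_le_const hε
  obtain ⟨V, hV, hVq⟩ := (@mem_nhdsWithin_iff_exists_mem_nhds_inter X 𝓢.tau _ _ _).1 hqε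
  filter_upwards [hS.locally_bi_equicontinuous y 0 ⟨R, hR⟩ hy t₀ V hV] with n hn t ht
  rw [sub_zero] at hn
  refine hVq ⟨hn t ht, mem_closedBall_zero_iff.2 (((S t).le_opNorm _).trans ?_)⟩
  exact mul_le_mul (hC t ht) (hR (mem_range_self n)) (norm_nonneg _) hC0

theorem eventually_exp_mul_seminorm_le (hS : IsLocallyBicontinuousFamily 𝓢 S) {α M : ℝ}
    (hα : 0 ≤ α) (hM0 : 0 ≤ M)
    (hM : ∀ (t : ℝ≥0) (x : X), Real.exp (-α * t) * ‖S t x‖ ≤ M * Real.exp (-t) * ‖x‖)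
    {q : Seminorm 𝕜 X} (hq : Continuous[𝓢.gamma, inferInstance] q) {y : ℕ → X}
    (hyb : BddAbove (range fun n => ‖y n‖)) (hy : Tendsto y atTop (@nhds X 𝓢.tau 0))
    {ε : ℝ} (hε : 0 < ε) : ∀ᶠ n in atTop, ∀ t : ℝ≥0, Real.exp (-α * t) * q (S t (y n)) ≤ ε := by
  obtain ⟨R, hR⟩ := id hyb
  obtain ⟨C, hC0, hC⟩ := q.bound_of_continuous_normedSpace (continuous_le_dom 𝓢.norm_le_gamma hq)
  have hdecay : Tendsto (fun t : ℝ => C * M * R * Real.exp (-t)) atTop (𝓝 0) := by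
    simpa using Real.tendsto_exp_neg_atTop_nhds_zero.const_mul (C * M * R)
  obtain ⟨t₀, ht₀, ht₀0⟩ := ((hdecay.eventually_le_const hε).and (eventually_ge_atTop 0)).exists
  lift t₀ to ℝ≥0 using ht₀0
  filter_upwards [hS.eventually_seminorm_le hq hyb hy t₀ hε] with n hn t
  rcases le_total t t₀ with ht | ht
  · refine (mul_le_of_le_one_left (apply_nonneg _ _) (Real.exp_le_one_iff.2 ?_)).trans (hn t ht)
    exact mul_nonpos_of_nonpos_of_nonneg (neg_nonpos.2 hα) t.2
  · have hyR : ‖y n‖ ≤ R := hR (mem_range_self n)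
    calc Real.exp (-α * t) * q (S t (y n))
        ≤ Real.exp (-α * t) * (C * ‖S t (y n)‖) := by gcongr; exact hC _
      _ = C * (Real.exp (-α * t) * ‖S t (y n)‖) := by ring
      _ ≤ C * (M * Real.exp (-t₀) * R) := by
        refine mul_le_mul_of_nonneg_left ((hM t _).trans ?_) hC0.le
        gcongr
      _ = C * M * R * Real.exp (-t₀) := by ring
      _ ≤ ε := ht₀

theorem continuous_gamma (hS : IsLocallyBicontinuousFamily 𝓢 S) (x : X) :
    Continuous[inferInstance, 𝓢.gamma] fun t => S t x := by
  refine (@continuous_iff_continuousAt _ _ _ 𝓢.gamma _).2 fun t₀ => ?_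
  obtain ⟨C, -, hC⟩ := hS.exists_norm_le (t₀ + 1)
  have hbdd : ∀ᶠ t in 𝓝 t₀, ‖S t x‖ ≤ C * ‖x‖ := by
    filter_upwards [eventually_le_nhds (lt_add_one t₀)] with t ht
    exact (S t).le_of_opNorm_le (hC t (by exact_mod_cast ht)) x
  exact SaksSpace.tendsto_gamma hbdd
    (@Continuous.tendsto _ _ _ 𝓢.tau _ (hS.strongly_continuous x) t₀)

variable [IsScalarTower ℝ 𝕜 X]

theorem exists_exp_mul_seminorm_le (hS : IsLocallyBicontinuousFamily 𝓢 S)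
    (h𝓢 : 𝓢.CSequential) :
    ∃ α : ℝ, 0 ≤ α ∧ ∀ q : Seminorm 𝕜 X, Continuous[𝓢.gamma, inferInstance] q →
      ∃ p : Seminorm 𝕜 X, Continuous[𝓢.gamma, inferInstance] p ∧
        ∀ (t : ℝ≥0) (x : X), Real.exp (-α * t) * q (S t x) ≤ p x := by
  obtain ⟨α, M, hα, hM0, hM⟩ := hS.exists_exp_mul_norm_le
  refine ⟨α, hα, fun q hq => ?_⟩
  obtain ⟨C, hC0, hC⟩ := q.bound_of_continuous_normedSpace (continuous_le_dom 𝓢.norm_le_gamma hq)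
  let F (t : ℝ≥0) : Seminorm 𝕜 X := q.comp (((Real.exp (-α * t) : ℝ) : 𝕜) • (S t).toLinearMap)
  have hF (t x) : F t x = Real.exp (-α * t) * q (S t x) := by
    simp only [F, Seminorm.comp_apply, LinearMap.smul_apply, map_smul_eq_mul, RCLike.norm_ofReal,
      abs_of_pos (Real.exp_pos _), ContinuousLinearMap.coe_coe]
  have hFx (x : X) : BddAbove (range fun t => F t x) := by
    refine ⟨C * (M * 1 * ‖x‖), forall_mem_range.2 fun t => ?_⟩
    calc F t x ≤ Real.exp (-α * t) * (C * ‖S t x‖) := by rw [hF]; gcongr; exact hC _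
      _ = C * (Real.exp (-α * t) * ‖S t x‖) := by ring
      _ ≤ C * (M * 1 * ‖x‖) := by
        refine mul_le_mul_of_nonneg_left ((hM t x).trans ?_) hC0.le
        gcongr
        exact Real.exp_le_one_iff.2 (neg_nonpos.2 t.2)
  have hbdd : BddAbove (range F) := Seminorm.bddAbove_range_iff.2 hFx
  refine ⟨⨆ t, F t, h𝓢.continuous_iSup_seminorm hbdd fun y hyb hy ε hε => ?_, fun t x => ?_⟩
  · simpa only [hF] using hS.eventually_exp_mul_seminorm_le hα hM0 hM hq hyb hy hε
  · rw [Seminorm.iSup_apply hbdd, ← hF]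
    exact le_ciSup (hFx x) t

theorem exists_seminorm_le (hS : IsLocallyBicontinuousFamily 𝓢 S) (h𝓢 : 𝓢.CSequential) (T : ℝ)
    {q : Seminorm 𝕜 X} (hq : Continuous[𝓢.gamma, inferInstance] q) :
    ∃ p : Seminorm 𝕜 X, Continuous[𝓢.gamma, inferInstance] p ∧
      ∀ t : ℝ≥0, t ≤ T → ∀ x, q (S t x) ≤ p x := by
  obtain ⟨α, hα, h⟩ := hS.exists_exp_mul_seminorm_le h𝓢
  obtain ⟨p, hp, hpq⟩ := h q hq
  let c : ℝ≥0 := ⟨Real.exp (α * T), (Real.exp_pos _).le⟩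
  refine ⟨c • p, @Continuous.const_smul ℝ≥0 ℝ X _ _ _ 𝓢.gamma p hp c, fun t ht x => ?_⟩
  calc q (S t x) = Real.exp (α * t) * (Real.exp (-α * t) * q (S t x)) := by
        rw [← mul_assoc, ← Real.exp_add]; simp
    _ ≤ Real.exp (α * T) * p x := by
        have := apply_nonneg q (S t x)
        gcongr
        exact hpq t x

theorem tendsto_gamma (hS : IsLocallyBicontinuousFamily 𝓢 S) (h𝓢 : 𝓢.CSequential) {ι : Type*}
    {l : Filter ι} {r : ι → ℝ≥0} {t₀ : ℝ≥0} (hr : Tendsto r l (𝓝 t₀)) {x : ι → X} {a : X}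
    (hx : Tendsto x l (@nhds X 𝓢.gamma a)) :
    Tendsto (fun i => S (r i) (x i)) l (@nhds X 𝓢.gamma (S t₀ a)) := by
  refine (tendsto_nhds_iff_forall_seminorm (𝕜 := 𝕜)).2 fun q hq => ?_
  obtain ⟨p, hp, hpq⟩ := hS.exists_seminorm_le h𝓢 (t₀ + 1) hq
  have hpx : Tendsto (fun i => p (x i - a)) l (𝓝 0) :=
    tendsto_nhds_iff_forall_seminorm.1 hx p hp
  have hSa : Tendsto (fun i => q (S (r i) a - S t₀ a)) l (𝓝 0) :=
    tendsto_nhds_iff_forall_seminorm.1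
      ((@Continuous.tendsto _ _ _ 𝓢.gamma _ (hS.continuous_gamma a) t₀).comp hr) q hq
  refine squeeze_zero' (.of_forall fun i => apply_nonneg q _) ?_ (by simpa using hpx.add hSa)
  filter_upwards [hr.eventually_le_const (lt_add_one t₀)] with i hi
  calc q (S (r i) (x i) - S t₀ a) = q (S (r i) (x i - a) + (S (r i) a - S t₀ a)) := by simp
    _ ≤ q (S (r i) (x i - a)) + q (S (r i) a - S t₀ a) := map_add_le_add q _ _
    _ ≤ p (x i - a) + q (S (r i) a - S t₀ a) := by
      gcongr
      exact hpq _ (by exact_mod_cast hi) _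

end IsLocallyBicontinuousFamily

variable {𝓢U : SaksSpace 𝕜 U} {B : U →L[𝕜] X}

theorem ContinuousOnBounded.continuous_gamma (hB : ContinuousOnBounded 𝓢U 𝓢 B) :
    Continuous[𝓢U.gamma, 𝓢.gamma] B := by
  refine SaksSpace.continuous_gamma_of_tendsto (t := 𝓢.gamma) (F := B.toLinearMap) fun R =>
    Tendsto.mono_right (𝓢.tendsto_nhdsInBall.2 ⟨?_, ?_⟩) (𝓢.nhdsInBall_le_nhds_gamma (‖B‖ * R))
  · have h : Tendsto B (𝓢U.nhdsInBall |R|) (@nhds X 𝓢.tau (B 0)) :=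
      hB _ Metric.isBounded_closedBall 0 (Metric.mem_closedBall_self (abs_nonneg R))
    rw [map_zero] at h
    exact h.mono_left
      (@nhdsWithin_mono U 𝓢U.tau _ _ _ (Metric.closedBall_subset_closedBall (le_abs_self R)))
  · filter_upwards [(𝓢U.tendsto_nhdsInBall.1 tendsto_id).2] with u hu
    exact B.le_opNorm_of_le hu

theorem ContinuousOnBounded.continuous_seminorm_comp (hB : ContinuousOnBounded 𝓢U 𝓢 B)
    {q : Seminorm 𝕜 X} (hq : Continuous[𝓢.gamma, inferInstance] q) :
    Continuous[𝓢U.gamma, inferInstance] (q.comp B.toLinearMap) :=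
  @Continuous.comp U X ℝ 𝓢U.gamma 𝓢.gamma _ _ _ hq hB.continuous_gamma

theorem IsLocallyBicontinuousFamily.quasiEquicontinuous_comp [IsScalarTower ℝ 𝕜 X]
    (hS : IsLocallyBicontinuousFamily 𝓢 S) (h𝓢 : 𝓢.CSequential)
    (hB : ContinuousOnBounded 𝓢U 𝓢 B) :
    QuasiEquicontinuous 𝓢U.gamma 𝓢.gamma
      (fun t => ((S t).comp B : U →L[𝕜] X).toLinearMap) := by
  obtain ⟨α, -, h⟩ := hS.exists_exp_mul_seminorm_le h𝓢
  refine ⟨α, fun V hV => ?_⟩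
  obtain ⟨q, hq, hqV⟩ := exists_seminorm_ball_subset (𝕜 := 𝕜) hV
  obtain ⟨p, hp, hpq⟩ := h q hq
  have hpB := tendsto_seminorm_nhds_zero (hB.continuous_seminorm_comp hp)
  refine ⟨_, hpB.eventually_lt_const one_pos, fun t u hu => hqV ?_⟩
  rw [Seminorm.mem_ball_zero, map_smul_eq_mul, RCLike.norm_ofReal, abs_of_pos (Real.exp_pos _)]
  exact (hpq t (B u)).trans_lt hu

end BicontinuousFamily

section Pettis

theorem exists_simpleFunc_tendsto_id (Ω : Type*) [PseudoEMetricSpace Ω]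
    [TopologicalSpace.SeparableSpace Ω] [MeasurableSpace Ω] [OpensMeasurableSpace Ω] :
    ∃ g : ℕ → SimpleFunc Ω Ω, ∀ ω, Tendsto (fun n => g n ω) atTop (𝓝 ω) := by
  rcases isEmpty_or_nonempty Ω with _ | ⟨⟨ω₀⟩⟩
  · exact ⟨fun _ => SimpleFunc.ofIsEmpty, isEmptyElim⟩
  · exact ⟨SimpleFunc.approxOn id measurable_id univ ω₀ (mem_univ ω₀), fun ω =>
      SimpleFunc.tendsto_approxOn measurable_id (mem_univ ω₀) (by simp)⟩

variable {𝕜 Ω : Type*} [RCLike 𝕜] [MeasurableSpace Ω] {μ : Measure Ω}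

theorem integrable_seminorm_comp {E : Type*} [NormedAddCommGroup E] [NormedSpace 𝕜 E]
    {q : Seminorm 𝕜 E} (hq : Continuous q) {f : Ω → E} (hf : Integrable f μ) :
    Integrable (fun ω => q (f ω)) μ := by
  obtain ⟨C, -, hC⟩ := q.bound_of_continuous_normedSpace hq
  refine (hf.norm.const_mul C).mono' (hq.comp_aestronglyMeasurable hf.aestronglyMeasurable)
    (.of_forall fun ω => ?_)
  rw [Real.norm_of_nonneg (apply_nonneg _ _)]
  exact hC (f ω)

section VectorSpace

variable {X : Type*} [AddCommGroup X] [Module 𝕜 X] {t : TopologicalSpace X} {f g : Ω → X}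
  {x y : X}

namespace HasPettisIntegral

theorem add (hf : HasPettisIntegral 𝕜 t μ f x) (hg : HasPettisIntegral 𝕜 t μ g y) :
    HasPettisIntegral 𝕜 t μ (fun ω => f ω + g ω) (x + y) := fun φ hφ => by
  simp only [map_add]
  exact ⟨(hf φ hφ).1.add (hg φ hφ).1, by
    rw [integral_add (hf φ hφ).1 (hg φ hφ).1, (hf φ hφ).2, (hg φ hφ).2]⟩

theorem smul (c : 𝕜) (hf : HasPettisIntegral 𝕜 t μ f x) :
    HasPettisIntegral 𝕜 t μ (fun ω => c • f ω) (c • x) := fun φ hφ => by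
  simp only [map_smul]
  exact ⟨(hf φ hφ).1.smul c, by rw [integral_smul, (hf φ hφ).2]⟩

theorem mono {s : TopologicalSpace X} (hst : s ≤ t) (hf : HasPettisIntegral 𝕜 s μ f x) :
    HasPettisIntegral 𝕜 t μ f x :=
  fun φ hφ => hf φ (continuous_le_dom hst hφ)

theorem seminorm_le_integral [IsTopologicalAddGroup X] (hf : HasPettisIntegral 𝕜 t μ f x)
    {q : Seminorm 𝕜 X} (hq : Continuous q) {b : Ω → ℝ} (hb : Integrable b μ)
    (hfb : ∀ᵐ ω ∂μ, q (f ω) ≤ b ω) : q x ≤ ∫ ω, b ω ∂μ := by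
  obtain ⟨φ, hφx, hφ⟩ := exists_linearMap_apply_eq_seminorm q x
  calc q x = ‖∫ ω, φ (f ω) ∂μ‖ := by
        rw [(hf φ (continuous_of_norm_le_seminorm hq hφ)).2, hφx, RCLike.norm_ofReal,
          abs_of_nonneg (apply_nonneg q x)]
    _ ≤ ∫ ω, b ω ∂μ :=
        norm_integral_le_of_norm_le hb (hfb.mono fun ω hω => (hφ (f ω)).trans hω)

end HasPettisIntegral

end VectorSpace

variable {X : Type*} [NormedAddCommGroup X] [NormedSpace 𝕜 X] [NormedSpace ℝ X]
  {𝓢 : SaksSpace 𝕜 X} {f : Ω → X} {x y : X}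

theorem hasPettisIntegral_integral [CompleteSpace X] (hf : Integrable f μ) :
    HasPettisIntegral 𝕜 (normTopology X) μ f (∫ ω, f ω ∂μ) := fun φ hφ =>
  let Φ : X →L[𝕜] 𝕜 := ⟨φ, hφ⟩
  ⟨Φ.integrable_comp hf, Φ.integral_comp_comm hf⟩

namespace HasPettisIntegral

theorem norm_le_integral (hf : HasPettisIntegral 𝕜 𝓢.tau μ f x) {b : Ω → ℝ}
    (hb : Integrable b μ) (hfb : ∀ᵐ ω ∂μ, ‖f ω‖ ≤ b ω) : ‖x‖ ≤ ∫ ω, b ω ∂μ := by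
  refine (𝓢.norming x).2 ?_
  rintro _ ⟨φ, hφ, hφ1, rfl⟩
  rw [← (hf φ hφ).2]
  exact norm_integral_le_of_norm_le hb (hfb.mono fun ω hω => (hφ1 _).trans hω)

theorem unique (hx : HasPettisIntegral 𝕜 𝓢.tau μ f x) (hy : HasPettisIntegral 𝕜 𝓢.tau μ f y) :
    x = y := by
  have hsub : HasPettisIntegral 𝕜 𝓢.tau μ (fun _ => 0) (x - y) := by
    simpa [sub_eq_add_neg] using hx.add (hy.smul (-1))
  refine sub_eq_zero.1 (norm_le_zero_iff.1 ?_)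
  simpa using hsub.norm_le_integral (integrable_zero Ω ℝ μ) (by simp)

theorem pettisIntegral_eq (hx : HasPettisIntegral 𝕜 𝓢.tau μ f x) :
    pettisIntegral 𝕜 𝓢.tau μ f = x := by
  have h : ∃ x, HasPettisIntegral 𝕜 𝓢.tau μ f x := ⟨x, hx⟩
  rw [pettisIntegral, dif_pos h]
  exact h.choose_spec.unique hx

end HasPettisIntegral

theorem tendsto_integral_seminorm_sub {q : Seminorm 𝕜 X}
    (hq : Continuous[𝓢.gamma, inferInstance] q) {h : ℕ → Ω → X} {b : Ω → ℝ}
    (hmeas : ∀ n, AEStronglyMeasurable (h n) μ) (hb : Integrable b μ)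
    (hhb : ∀ n, ∀ᵐ ω ∂μ, ‖h n ω‖ ≤ b ω)
    (hf : ∀ᵐ ω ∂μ, Tendsto (fun n => h n ω) atTop (@nhds X 𝓢.gamma (f ω))) :
    Tendsto (fun k : ℕ × ℕ => ∫ ω, q (h k.1 ω - h k.2 ω) ∂μ) atTop (𝓝 0) := by
  have hq' : Continuous q := continuous_le_dom 𝓢.norm_le_gamma hq
  obtain ⟨C, hC0, hC⟩ := q.bound_of_continuous_normedSpace hq'
  rw [← integral_zero Ω ℝ (μ := μ)]
  refine tendsto_integral_filter_of_dominated_convergence (fun ω => C * (b ω + b ω))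
    (.of_forall fun k => hq'.comp_aestronglyMeasurable ((hmeas k.1).sub (hmeas k.2)))
    (.of_forall fun k => ?_) ((hb.add hb).const_mul C) ?_
  · filter_upwards [hhb k.1, hhb k.2] with ω h₁ h₂
    rw [Real.norm_of_nonneg (apply_nonneg _ _)]
    exact (hC _).trans (by gcongr; exact norm_sub_le_of_le h₁ h₂)
  · filter_upwards [hf] with ω hω
    rw [← prod_atTop_atTop_eq]
    have hsub : Tendsto (fun k : ℕ × ℕ => h k.1 ω - h k.2 ω) (atTop ×ˢ atTop)
        (@nhds X 𝓢.gamma (f ω - f ω)) :=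
      @Tendsto.sub X _ 𝓢.gamma _ _ _ _ _ _ _ (hω.comp tendsto_fst) (hω.comp tendsto_snd)
    rw [sub_self] at hsub
    exact (tendsto_seminorm_nhds_zero hq).comp hsub

theorem hasPettisIntegral_of_tendsto_integral [CompleteSpace X] {h : ℕ → Ω → X} {b : Ω → ℝ}
    (hmeas : ∀ n, AEStronglyMeasurable (h n) μ) (hb : Integrable b μ)
    (hhb : ∀ n, ∀ᵐ ω ∂μ, ‖h n ω‖ ≤ b ω)
    (hf : ∀ᵐ ω ∂μ, Tendsto (fun n => h n ω) atTop (@nhds X 𝓢.gamma (f ω)))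
    (hx : Tendsto (fun n => ∫ ω, h n ω ∂μ) atTop (@nhds X 𝓢.gamma x)) :
    HasPettisIntegral 𝕜 𝓢.gamma μ f x := fun φ hφ => by
  let Φ : X →L[𝕜] 𝕜 := ⟨φ, continuous_le_dom 𝓢.norm_le_gamma hφ⟩
  have hφm (n : ℕ) : AEStronglyMeasurable (fun ω => φ (h n ω)) μ :=
    Φ.continuous.comp_aestronglyMeasurable (hmeas n)
  have hφb (n : ℕ) : ∀ᵐ ω ∂μ, ‖φ (h n ω)‖ ≤ ‖Φ‖ * b ω :=
    (hhb n).mono fun ω hω => Φ.le_opNorm_of_le hω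
  have hφf : ∀ᵐ ω ∂μ, Tendsto (fun n => φ (h n ω)) atTop (𝓝 (φ (f ω))) :=
    hf.mono fun ω hω => (@Continuous.tendsto X 𝕜 𝓢.gamma _ φ hφ _).comp hω
  have hlim := tendsto_integral_of_dominated_convergence _ hφm (hb.const_mul ‖Φ‖) hφb hφf
  have hφx : Tendsto (fun n => ∫ ω, φ (h n ω) ∂μ) atTop (𝓝 (φ x)) := by
    have hint (n : ℕ) : ∫ ω, φ (h n ω) ∂μ = φ (∫ ω, h n ω ∂μ) :=
      Φ.integral_comp_comm (hb.mono' (hmeas n) (hhb n))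
    simp only [hint]
    exact (@Continuous.tendsto X 𝕜 𝓢.gamma _ φ hφ x).comp hx
  refine ⟨?_, tendsto_nhds_unique hlim hφx⟩
  refine (hb.const_mul ‖Φ‖).mono' (aestronglyMeasurable_of_tendsto_ae _ hφm hφf) ?_
  filter_upwards [hφf, ae_all_iff.2 hφb] with ω hω hωb using le_of_tendsto' hω.norm hωb

namespace SaksSpace

variable [IsScalarTower ℝ 𝕜 X]

theorem SequentiallyComplete.exists_hasPettisIntegral_of_tendsto (h𝓢 : 𝓢.SequentiallyComplete)
    {h : ℕ → Ω → X} {b : Ω → ℝ} (hmeas : ∀ n, AEStronglyMeasurable (h n) μ)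
    (hb : Integrable b μ) (hhb : ∀ n, ∀ᵐ ω ∂μ, ‖h n ω‖ ≤ b ω)
    (hf : ∀ᵐ ω ∂μ, Tendsto (fun n => h n ω) atTop (@nhds X 𝓢.gamma (f ω))) :
    ∃ x, HasPettisIntegral 𝕜 𝓢.gamma μ f x := by
  have := 𝓢.complete
  have hint (n : ℕ) : Integrable (h n) μ := hb.mono' (hmeas n) (hhb n)
  obtain ⟨x, hx⟩ := h𝓢 (fun n => ∫ ω, h n ω ∂μ) fun V hV => by
    obtain ⟨q, hq, hqV⟩ := exists_seminorm_ball_subset (𝕜 := 𝕜) hV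
    have hq' : Continuous q := continuous_le_dom 𝓢.norm_le_gamma hq
    obtain ⟨N, hN⟩ := eventually_atTop_prod_self'.1
      ((tendsto_integral_seminorm_sub hq hmeas hb hhb hf).eventually_lt_const one_pos)
    refine ⟨N, fun m hm n hn => hqV ?_⟩
    have hsub := (hint m).sub (hint n)
    have hqsub : Integrable (fun ω => q (h m ω - h n ω)) μ := integrable_seminorm_comp hq' hsub
    rw [Seminorm.mem_ball_zero, ← integral_sub (hint m) (hint n)]
    exact ((hasPettisIntegral_integral hsub).seminorm_le_integral hq' hqsub
      (.of_forall fun _ => le_rfl)).trans_lt (hN m hm n hn)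
  exact ⟨x, hasPettisIntegral_of_tendsto_integral hmeas hb hhb hf hx⟩

theorem SequentiallyComplete.exists_hasPettisIntegral_of_continuous
    [PseudoEMetricSpace Ω] [TopologicalSpace.SeparableSpace Ω] [OpensMeasurableSpace Ω]
    [IsFiniteMeasure μ] (h𝓢 : 𝓢.SequentiallyComplete)
    (hf : Continuous[inferInstance, 𝓢.gamma] f) {C : ℝ} (hC : ∀ ω, ‖f ω‖ ≤ C) :
    ∃ x, HasPettisIntegral 𝕜 𝓢.gamma μ f x := by
  obtain ⟨g, hg⟩ := exists_simpleFunc_tendsto_id Ω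
  exact h𝓢.exists_hasPettisIntegral_of_tendsto
    (fun n => ((g n).map f).stronglyMeasurable.aestronglyMeasurable) (integrable_const C)
    (fun n => .of_forall fun ω => hC (g n ω))
    (.of_forall fun ω => (@Continuous.tendsto _ _ _ 𝓢.gamma f hf ω).comp (hg ω))

end SaksSpace

end Pettis

section InputMap

instance isFiniteMeasure_lebesgueIcc (T : ℝ) : IsFiniteMeasure (lebesgueIcc T) := by
  refine ⟨?_⟩
  rw [lebesgueIcc, (MeasurableEmbedding.subtype_coe measurableSet_Icc).comap_apply, image_univ,
    Subtype.range_coe]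
  exact isCompact_Icc.measure_lt_top

namespace Ctb

variable {𝕜 U : Type*} [RCLike 𝕜] [NormedAddCommGroup U] [NormedSpace 𝕜 U] [NormedSpace ℝ U]
  {𝓢 : SaksSpace 𝕜 U} {T : ℝ}

theorem norm_eval_le (u : Ctb 𝓢 T) (t : Icc (0 : ℝ) T) : ‖eval 𝓢 T t u‖ ≤ ‖u‖ :=
  lp.norm_apply_le_norm (E := fun _ : Icc (0 : ℝ) T => U) ENNReal.top_ne_zero _ t

theorem continuous_gamma_eval (u : Ctb 𝓢 T) :
    Continuous[inferInstance, 𝓢.gamma] fun t => eval 𝓢 T t u :=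
  (@continuous_iff_continuousAt _ _ _ 𝓢.gamma _).2 fun t =>
    SaksSpace.tendsto_gamma (.of_forall fun s => norm_eval_le u s)
      (@Continuous.tendsto _ _ _ 𝓢.tau _ u.2 t)

theorem seminorm_eval_le_supSeminorm {p : Seminorm 𝕜 U}
    (hp : Continuous[𝓢.gamma, inferInstance] p) (u : Ctb 𝓢 T) (t : Icc (0 : ℝ) T) :
    p (eval 𝓢 T t u) ≤ supSeminorm 𝓢 T p u := by
  obtain ⟨C, hC0, hC⟩ := p.bound_of_continuous_normedSpace (continuous_le_dom 𝓢.norm_le_gamma hp)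
  have hbdd : BddAbove (range fun t => p (eval 𝓢 T t u)) := by
    refine ⟨C * ‖u‖, forall_mem_range.2 fun s => (hC _).trans ?_⟩
    gcongr
    exact norm_eval_le u s
  rw [supSeminorm_apply 𝓢 T p hp]
  exact le_ciSup hbdd t

variable (𝓢 T) in
theorem withSeminorms_gammaInfty :
    @WithSeminorms 𝕜 (Ctb 𝓢 T) _ _ _ _
      (fun p : {p : Seminorm 𝕜 U // Continuous[𝓢.gamma, inferInstance] p} =>
        supSeminorm 𝓢 T p.1) (gammaInfty 𝓢 T) :=
  @WithSeminorms.mk 𝕜 _ _ _ _ _ _ (gammaInfty 𝓢 T) rfl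

instance isTopologicalAddGroup_gammaInfty :
    @IsTopologicalAddGroup (Ctb 𝓢 T) (gammaInfty 𝓢 T) _ :=
  let _ := gammaInfty 𝓢 T
  (withSeminorms_gammaInfty 𝓢 T).topologicalAddGroup

theorem continuous_supSeminorm {p : Seminorm 𝕜 U}
    (hp : Continuous[𝓢.gamma, inferInstance] p) :
    Continuous[gammaInfty 𝓢 T, inferInstance] (supSeminorm 𝓢 T p) :=
  let _ := gammaInfty 𝓢 T
  (withSeminorms_gammaInfty 𝓢 T).continuous_seminorm ⟨p, hp⟩

end Ctb

variable {𝕜 X U : Type*} [RCLike 𝕜] [NormedAddCommGroup X] [NormedSpace 𝕜 X]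
  [NormedAddCommGroup U] [NormedSpace 𝕜 U] [NormedSpace ℝ U]
  {𝓢U : SaksSpace 𝕜 U} {S : ℝ≥0 → X →L[𝕜] X} {B : U →L[𝕜] X} {T : ℝ}

theorem norm_inputIntegrand_le {C : ℝ} (hC : ∀ t : ℝ≥0, (t : ℝ) ≤ T → ‖S t‖ ≤ C)
    (u : Ctb 𝓢U T) (t : Icc (0 : ℝ) T) :
    ‖inputIntegrand 𝓢U S B T u t‖ ≤ C * (‖B‖ * ‖u‖) :=
  (S _).le_of_opNorm_le_of_le (hC _ (sub_le_self T t.2.1))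
    (B.le_opNorm_of_le (Ctb.norm_eval_le u t))

variable [NormedSpace ℝ X] [IsScalarTower ℝ 𝕜 X] {𝓢X : SaksSpace 𝕜 X}

theorem continuous_gamma_inputIntegrand (hX : 𝓢X.CSequential)
    (hS : IsLocallyBicontinuousFamily 𝓢X S) (hB : ContinuousOnBounded 𝓢U 𝓢X B)
    (u : Ctb 𝓢U T) : Continuous[inferInstance, 𝓢X.gamma] (inputIntegrand 𝓢U S B T u) := by
  refine (@continuous_iff_continuousAt _ _ _ 𝓢X.gamma _).2 fun t => ?_
  have hr : Continuous fun s : Icc (0 : ℝ) T => (⟨T - s, sub_nonneg.2 s.2.2⟩ : ℝ≥0) := by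
    fun_prop
  have hBu : Continuous[inferInstance, 𝓢X.gamma] fun s => B (Ctb.eval 𝓢U T s u) :=
    @Continuous.comp _ _ _ _ 𝓢U.gamma 𝓢X.gamma _ _ hB.continuous_gamma (Ctb.continuous_gamma_eval u)
  exact hS.tendsto_gamma hX (hr.tendsto t) (@Continuous.tendsto _ _ _ 𝓢X.gamma _ hBu t)

theorem hasPettisIntegral_inputMap (hX : 𝓢X.SequentiallyComplete) (hXC : 𝓢X.CSequential)
    (hS : IsLocallyBicontinuousFamily 𝓢X S) (hB : ContinuousOnBounded 𝓢U 𝓢X B)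
    (u : Ctb 𝓢U T) :
    HasPettisIntegral 𝕜 𝓢X.gamma (lebesgueIcc T) (inputIntegrand 𝓢U S B T u)
      (inputMap 𝓢U 𝓢X S B T u) := by
  obtain ⟨C, -, hC⟩ := hS.exists_norm_le T
  obtain ⟨x, hx⟩ := hX.exists_hasPettisIntegral_of_continuous (μ := lebesgueIcc T)
    (continuous_gamma_inputIntegrand hXC hS hB u) (norm_inputIntegrand_le hC u)
  rwa [inputMap, (hx.mono 𝓢X.gamma_le_tau).pettisIntegral_eq]

/-- The input map `𝓑^T` as a bounded operator `C_{τ,b}([0,T];U) → X` for the norms. -/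
noncomputable def inputMapCLM (hX : 𝓢X.SequentiallyComplete) (hXC : 𝓢X.CSequential)
    (hS : IsLocallyBicontinuousFamily 𝓢X S) (hB : ContinuousOnBounded 𝓢U 𝓢X B) (T : ℝ) :
    Ctb 𝓢U T →L[𝕜] X :=
  have hτ (u : Ctb 𝓢U T) := (hasPettisIntegral_inputMap hX hXC hS hB u).mono 𝓢X.gamma_le_tau
  LinearMap.mkContinuousOfExistsBound
    { toFun := inputMap 𝓢U 𝓢X S B T
      map_add' := fun u v => (hτ (u + v)).unique <| by
        convert (hτ u).add (hτ v) using 2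
        simp [inputIntegrand]
      map_smul' := fun c u => (hτ (c • u)).unique <| by
        rw [RingHom.id_apply]
        convert (hτ u).smul c using 2
        simp [inputIntegrand] } <| by
    obtain ⟨C, -, hC⟩ := hS.exists_norm_le T
    refine ⟨(lebesgueIcc T).real univ * (C * ‖B‖), fun u => ?_⟩
    calc ‖inputMap 𝓢U 𝓢X S B T u‖ ≤ ∫ _, C * (‖B‖ * ‖u‖) ∂lebesgueIcc T :=
          (hτ u).norm_le_integral (integrable_const _) (.of_forall (norm_inputIntegrand_le hC u))
      _ = (lebesgueIcc T).real univ * (C * ‖B‖) * ‖u‖ := by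
          rw [integral_const, smul_eq_mul]; ring

theorem continuous_gamma_inputMapCLM (hX : 𝓢X.SequentiallyComplete) (hXC : 𝓢X.CSequential)
    (hS : IsLocallyBicontinuousFamily 𝓢X S) (hB : ContinuousOnBounded 𝓢U 𝓢X B) (T : ℝ) :
    Continuous[gammaInfty 𝓢U T, 𝓢X.gamma] (inputMapCLM hX hXC hS hB T) := by
  refine continuous_of_forall_seminorm_le (t := gammaInfty 𝓢U T) (s := 𝓢X.gamma)
    (L := (inputMapCLM hX hXC hS hB T).toLinearMap) fun q hq => ?_
  obtain ⟨p, hp, hpq⟩ := hS.exists_seminorm_le hXC T hq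
  have hpB := hB.continuous_seminorm_comp hp
  refine ⟨_, Ctb.continuous_supSeminorm hpB, (lebesgueIcc T).real univ, fun u => ?_⟩
  calc q (inputMap 𝓢U 𝓢X S B T u)
      ≤ ∫ _, Ctb.supSeminorm 𝓢U T (p.comp B.toLinearMap) u ∂lebesgueIcc T :=
        (hasPettisIntegral_inputMap hX hXC hS hB u).seminorm_le_integral hq (integrable_const _)
          (.of_forall fun t => (hpq ⟨T - t, sub_nonneg.2 t.2.2⟩ (sub_le_self T t.2.1) _).trans
            (Ctb.seminorm_eval_le_supSeminorm hpB u t))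
    _ = (lebesgueIcc T).real univ * Ctb.supSeminorm 𝓢U T (p.comp B.toLinearMap) u := by
        rw [integral_const, smul_eq_mul]

end InputMap

end SaksControl

open SaksControl in
theorem mainTheorem9_general {𝕜 X U : Type*} [RCLike 𝕜]
    [NormedAddCommGroup X] [NormedSpace 𝕜 X] [NormedSpace ℝ X] [IsScalarTower ℝ 𝕜 X]
    [NormedAddCommGroup U] [NormedSpace 𝕜 U] [NormedSpace ℝ U]
    (𝓢X : SaksSpace 𝕜 X) (hX : 𝓢X.SequentiallyComplete) (hXC : 𝓢X.CSequential)
    (𝓢U : SaksSpace 𝕜 U)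
    (S : ℝ≥0 → X →L[𝕜] X) (hS : IsLocallyBicontinuousFamily 𝓢X S)
    (B : U →L[𝕜] X) (hB : ContinuousOnBounded 𝓢U 𝓢X B) :
    QuasiEquicontinuous 𝓢U.gamma 𝓢X.gamma
      (fun t => ((S t).comp B : U →L[𝕜] X).toLinearMap) ∧
    ∀ T : ℝ,
      (∀ u : Ctb 𝓢U T,
        HasPettisIntegral 𝕜 𝓢X.tau (lebesgueIcc T)
          (inputIntegrand 𝓢U S B T u)
          (inputMap 𝓢U 𝓢X S B T u) ∧
        HasPettisIntegral 𝕜 𝓢X.gamma (lebesgueIcc T)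
          (inputIntegrand 𝓢U S B T u)
          (inputMap 𝓢U 𝓢X S B T u)) ∧
      ∃ L : Ctb 𝓢U T →L[𝕜] X,
        (∀ u, L u = inputMap 𝓢U 𝓢X S B T u) ∧
        Continuous[gammaInfty 𝓢U T, 𝓢X.gamma] L ∧
        ∀ x' ∈ 𝓢X.circDual,
          Continuous[gammaInfty 𝓢U T, inferInstance] (x'.comp L) := by
  have hγ (T : ℝ) (u : Ctb 𝓢U T) := hasPettisIntegral_inputMap hX hXC hS hB u
  have hL (T : ℝ) := continuous_gamma_inputMapCLM hX hXC hS hB T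
  exact ⟨hS.quasiEquicontinuous_comp hXC hB, fun T =>
    ⟨fun u => ⟨(hγ T u).mono 𝓢X.gamma_le_tau, hγ T u⟩,
      inputMapCLM hX hXC hS hB T, fun _ => rfl, hL T, fun x' hx' =>
        @Continuous.comp _ _ _ (gammaInfty 𝓢U T) 𝓢X.gamma _ _ _
          (hXC.continuous_of_mem_circDual hx') (hL T)⟩⟩

theorem mainTheorem9 {𝕜 X U : Type*} [RCLike 𝕜]
    [NormedAddCommGroup X] [NormedSpace 𝕜 X] [NormedSpace ℝ X] [IsScalarTower ℝ 𝕜 X]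
    [NormedAddCommGroup U] [NormedSpace 𝕜 U] [NormedSpace ℝ U] [IsScalarTower ℝ 𝕜 U]
    (𝓢X : SaksControl.SaksSpace 𝕜 X) (hX : 𝓢X.SequentiallyComplete) (hXC : 𝓢X.CSequential)
    (𝓢U : SaksControl.SaksSpace 𝕜 U)
    (S : ℝ≥0 → X →L[𝕜] X) (hS : SaksControl.IsLocallyBicontinuousSemigroup 𝓢X S)
    (B : U →L[𝕜] X) (hB : SaksControl.ContinuousOnBounded 𝓢U 𝓢X B) :
    -- (a) quasi-equicontinuity of the family (S_t B)
    SaksControl.QuasiEquicontinuous 𝓢U.gamma 𝓢X.gamma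
      (fun t => ((S t).comp B : U →L[𝕜] X).toLinearMap) ∧
    ∀ T : ℝ, 0 < T →
      -- the integral defining the input map exists, for both topologies
      (∀ u : SaksControl.Ctb 𝓢U T,
        SaksControl.HasPettisIntegral 𝕜 𝓢X.tau (SaksControl.lebesgueIcc T)
          (SaksControl.inputIntegrand 𝓢U S B T u)
          (SaksControl.inputMap 𝓢U 𝓢X S B T u) ∧
        SaksControl.HasPettisIntegral 𝕜 𝓢X.gamma (SaksControl.lebesgueIcc T)
          (SaksControl.inputIntegrand 𝓢U S B T u)
          (SaksControl.inputMap 𝓢U 𝓢X S B T u)) ∧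
      -- (b) the input map is linear and norm-bounded, and continuous for the mixed topologies
      ∃ L : SaksControl.Ctb 𝓢U T →L[𝕜] X,
        (∀ u, L u = SaksControl.inputMap 𝓢U 𝓢X S B T u) ∧
        Continuous[SaksControl.gammaInfty 𝓢U T, 𝓢X.gamma] L ∧
        -- (c) the dual operator maps X° into the dual for the topology of C_{τ,b}([0,T];U)
        ∀ x' ∈ 𝓢X.circDual,
          Continuous[SaksControl.gammaInfty 𝓢U T, inferInstance] (x'.comp L) := by
  obtain ⟨hequi, hinput⟩ := mainTheorem9_general 𝓢X hX hXC 𝓢U S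
    hS.isLocallyBicontinuousFamily B hB
  exact ⟨hequi, fun T _ => hinput T⟩
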